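/- Let $n, s \in \mathbb N$ with $s \ge 4$, and let $k_0, k_1 \ge 0$. For $u : \mathbb R^n \times [0,T] \to \mathbb R$ write $\nabla^i u$ for the full $i$-th spatial derivative, $|\nabla^i u|$ for its Euclidean norm (so $|\nabla^i u|^2$ is the sum of the squares of all $i$-th order spatial partial derivatives, over ordered multi-indices $(j_1,\dots,j_i)\in\{1,\dots,n\}^i$), and $$Q_s(u)(x,t) = \Big( \sum_{i=1}^{s} |\nabla^i u|^{s/i}(x,t) \Big)^{4/s}.$$ Then there exists a constant $N = N(n,k_0,k_1,s) > 0$ with the following property. Let $0 < T < \infty$ and let $u : \mathbb R^n \times [0,T] \to \mathbb R$ be smooth (up to and including $t = 0$ and $t = T$) and satisfy $$\frac{\partial u}{\partial t} = -\Delta^2 u \quad \text{on } \mathbb R^n \times [0,T],$$ $$t\, Q_s(u)(x,t) \le k_0 \quad \text{for all } x \in \mathbb R^n,\ t \in [0,T],$$ $$\sup_{x \in B_1(0)} \ \sum_{i=0}^{2n+s+1} |\nabla^i u(x,0)|^2 \le k_1.$$ Then for all $x \in \overline{B_1(0)}$ and $t \in [0,T]$ with $(1-|x|)^4 \ge N t$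 and $t \le \frac1N$ one has both $$(1-|x|)^4\, Q_s(u)(x,t) \le N \qquad\text{and}\qquad |u(x,t)| \le \sqrt{k_1} + 1 .$$ -/

import Mathlib

open scoped ContDiff

noncomputable section

/-- The norm `|∇ⁱ f|(x)` of the full `i`-th derivative of `f` on `ℝⁿ`: the square root of the sum
of the squares of all partial derivatives `∇_{J 0} ⋯ ∇_{J (i-1)} f (x)`. -/
def gradNorm {n : ℕ} (i : ℕ) (f : EuclideanSpace ℝ (Fin n) → ℝ)
    (x : EuclideanSpace ℝ (Fin n)) : ℝ :=
  Real.sqrt (∑ J : Fin i → Fin n,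
    (iteratedFDeriv ℝ i f x (fun a => EuclideanSpace.single (J a) (1 : ℝ))) ^ 2)

/-- The bi-Laplacian `Δ² f = Δ (Δ f)`. -/
def biLaplacian {n : ℕ} (f : EuclideanSpace ℝ (Fin n) → ℝ) : EuclideanSpace ℝ (Fin n) → ℝ :=
  Laplacian.laplacian (Laplacian.laplacian f)

/-- `u : ℝⁿ × [0, T] → ℝ` is a smooth solution to `∂u/∂t = -Δ² u`. Smoothness is up to and
including the end times, where the time derivative is one-sided. The values of `u` at times outside
`[0, T]` play no role. -/
structure IsSmoothBiharmonicFlow {n : ℕ} (T : ℝ) (u : EuclideanSpace ℝ (Fin n) → ℝ → ℝ) :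
    Prop where
  smooth : ContDiffOn ℝ ∞ (fun p : EuclideanSpace ℝ (Fin n) × ℝ => u p.1 p.2)
    (Set.univ ×ˢ Set.Icc 0 T)
  equation : ∀ x : EuclideanSpace ℝ (Fin n), ∀ t ∈ Set.Icc 0 T,
    HasDerivWithinAt (fun τ => u x τ) (-biLaplacian (fun y => u y t) x) (Set.Icc 0 T) t

/-- `Q_s(u)(x, t) = (|∇ˢ u| + |∇ˢ⁻¹ u|^{s/(s-1)} + ⋯ + |∇ u|ˢ)^{4/s} (x, t)`, with spatial
derivatives. -/
def flowQ {n : ℕ} (s : ℕ) (u : EuclideanSpace ℝ (Fin n) → ℝ → ℝ)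
    (x : EuclideanSpace ℝ (Fin n)) (t : ℝ) : ℝ :=
  (∑ i ∈ Finset.Icc 1 s, gradNorm i (fun y => u y t) x ^ ((s : ℝ) / (i : ℝ))) ^ ((4 : ℝ) / (s : ℝ))

end

/-!
The equation is linear, so it can be tested against a localized fundamental solution.

The biharmonic heat kernel is `ρ⁻ⁿ K (x / ρ)` with `ρ⁴ = t`, where `K` is the inverse Fourier
transform of `exp (-(2π)⁴ ‖ξ‖⁴)`. It is a Schwartz function with `∫ K = 1`, and Euler's identity on
the Fourier side gives `4 Δ² K = div (x K)` (`exists_biharmonic_heat_profile`), which is the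
equation of the kernel.

After a parabolic rescaling by the distance `1 - ‖x‖` to the sphere, consider the unit ball and the
value at the origin at time `T ≤ 1` of `v = ∂ⱼ ∂^L u`. Let `κ` be the backward kernel with pole at
`(0, T)` and `φ` a cutoff that is one near the origin. The pairing `∫ v φ κ` tends to `v (0, T)` as
`τ → T` (`tendsto_testedSolution`), is bounded at `τ = 0` by `sup |v (·, 0)|` times the `L¹` norm of
`K`, and its time derivative is `∫ v (φ Δ² κ - Δ² (φ κ))` (`hasDerivAt_testedSolution`). The
commutator vanishes near the origin, and away from the origin the kernels have derivatives bounded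
uniformly up to the pole (`exists_bound_iterPartial_biLapCommutator`). Hence `∂^L` can be moved to
the commutator, leaving only `∂ⱼ u`. The hypothesis `t Q ≤ k₀` bounds `∂ⱼ u` by `(k₀ / τ) ^ (1/4)`,
which is integrable in time. This gives the interior estimate (`exists_interior_bound`), and
undoing the scaling gives `(1 - ‖x‖)ⁱ |∇ⁱ u| ≤ C` for `1 ≤ i ≤ s`, which is the bound on `Q`. As
`4 ≤ s`, it also bounds `∂ₜ u = -Δ² u` by a multiple of `(1 - ‖x‖) ^ (-4)`, and integrating in time
bounds `u`.
-/

/-! ### Partial derivatives on `ℝⁿ` -/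

section PartialDerivatives

variable {n : ℕ}

local notation "𝔼" => EuclideanSpace ℝ (Fin n)

/-- The partial derivative `∂ⱼ f` on `ℝⁿ`. -/
noncomputable def partialDeriv (j : Fin n) (f : 𝔼 → ℝ) : 𝔼 → ℝ :=
  fun x => fderiv ℝ f x (EuclideanSpace.single j 1)

/-- The iterated partial derivative along a list of coordinates, the head of the list being
differentiated first. For smooth functions the order does not matter. -/
noncomputable def iterPartial : List (Fin n) → (𝔼 → ℝ) → 𝔼 → ℝ
  | [], f => f
  | j :: L, f => iterPartial L (partialDeriv j f)

/-- The bi-Laplacian as the sum of the iterated partial derivatives `∂ᵢ∂ᵢ∂ⱼ∂ⱼ`; for smooth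
functions it is `biLaplacian`. -/
noncomputable def sumBiLap (f : 𝔼 → ℝ) : 𝔼 → ℝ :=
  fun x => ∑ i, ∑ j, iterPartial [j, j, i, i] f x

theorem contDiff_partialDeriv {f : 𝔼 → ℝ} (hf : ContDiff ℝ ∞ f) (j : Fin n) :
    ContDiff ℝ ∞ (partialDeriv j f) :=
  (hf.fderiv_right (m := ∞) (by simp)).clm_apply contDiff_const

theorem contDiff_iterPartial {f : 𝔼 → ℝ} (hf : ContDiff ℝ ∞ f) (L : List (Fin n)) :
    ContDiff ℝ ∞ (iterPartial L f) := by
  induction L generalizing f with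
  | nil => exact hf
  | cons j L ih => exact ih (contDiff_partialDeriv hf j)

theorem contDiff_sumBiLap {f : 𝔼 → ℝ} (hf : ContDiff ℝ ∞ f) : ContDiff ℝ ∞ (sumBiLap f) :=
  ContDiff.sum fun _ _ => ContDiff.sum fun _ _ => contDiff_iterPartial hf _

theorem iterPartial_append (L M : List (Fin n)) (f : 𝔼 → ℝ) :
    iterPartial (L ++ M) f = iterPartial M (iterPartial L f) := by
  induction L generalizing f with
  | nil => rfl
  | cons j L ih => exact ih _

theorem partialDeriv_comm {f : 𝔼 → ℝ} (hf : ContDiff ℝ ∞ f) (i j : Fin n) :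
    partialDeriv i (partialDeriv j f) = partialDeriv j (partialDeriv i f) := by
  have hd : Differentiable ℝ (fderiv ℝ f) :=
    (hf.fderiv_right (m := ∞) (by simp)).differentiable (by simp)
  have key : ∀ (k l : Fin n) (x : 𝔼), partialDeriv k (partialDeriv l f) x =
      fderiv ℝ (fderiv ℝ f) x (EuclideanSpace.single k 1) (EuclideanSpace.single l 1) := by
    intro k l x
    unfold partialDeriv
    rw [fderiv_clm_apply (hd x) (differentiableAt_const _)]
    simp
  funext x
  rw [key, key]
  exact ((contDiff_infty.1 hf 2).contDiffAt.isSymmSndFDerivAt (by simp)) _ _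

theorem iterPartial_partialDeriv {f : 𝔼 → ℝ} (hf : ContDiff ℝ ∞ f) (j : Fin n)
    (L : List (Fin n)) :
    iterPartial L (partialDeriv j f) = partialDeriv j (iterPartial L f) := by
  induction L generalizing f with
  | nil => rfl
  | cons k L ih =>
    change iterPartial L (partialDeriv k (partialDeriv j f)) = _
    rw [partialDeriv_comm hf k j, ih (contDiff_partialDeriv hf k)]
    rfl

theorem partialDeriv_add {f g : 𝔼 → ℝ} (hf : ContDiff ℝ ∞ f) (hg : ContDiff ℝ ∞ g)
    (j : Fin n) : partialDeriv j (f + g) = partialDeriv j f + partialDeriv j g := by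
  funext x
  simp [partialDeriv, fderiv_add (hf.differentiable (by simp) x) (hg.differentiable (by simp) x)]

theorem partialDeriv_const_smul (c : ℝ) (f : 𝔼 → ℝ) (j : Fin n) :
    partialDeriv j (c • f) = c • partialDeriv j f := by
  funext x
  simp [partialDeriv, fderiv_const_smul_field]

theorem iterPartial_add {f g : 𝔼 → ℝ} (hf : ContDiff ℝ ∞ f) (hg : ContDiff ℝ ∞ g)
    (L : List (Fin n)) : iterPartial L (f + g) = iterPartial L f + iterPartial L g := by
  induction L generalizing f g with
  | nil => rfl
  | cons j L ih =>
    simp only [iterPartial, partialDeriv_add hf hg]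
    exact ih (contDiff_partialDeriv hf j) (contDiff_partialDeriv hg j)

theorem iterPartial_const_smul (c : ℝ) (f : 𝔼 → ℝ) (L : List (Fin n)) :
    iterPartial L (c • f) = c • iterPartial L f := by
  induction L generalizing f with
  | nil => rfl
  | cons j L ih => simp only [iterPartial, partialDeriv_const_smul, ih]

theorem iterPartial_zero (L : List (Fin n)) : iterPartial L (0 : 𝔼 → ℝ) = 0 := by
  simpa using iterPartial_const_smul (0 : ℝ) (0 : 𝔼 → ℝ) L

theorem iterPartial_sum {ι : Type*} (s : Finset ι) {f : ι → 𝔼 → ℝ}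
    (hf : ∀ i, ContDiff ℝ ∞ (f i)) (L : List (Fin n)) :
    iterPartial L (∑ i ∈ s, f i) = ∑ i ∈ s, iterPartial L (f i) := by
  classical
  induction s using Finset.induction_on with
  | empty => simp [iterPartial_zero]
  | insert a s ha ih =>
    rw [Finset.sum_insert ha, Finset.sum_insert ha, iterPartial_add (hf a) _ L, ih]
    have : ContDiff ℝ ∞ (fun x => ∑ i ∈ s, f i x) := ContDiff.sum fun i _ => hf i
    convert this using 1
    funext x
    simp

theorem sumBiLap_eq_sum (f : 𝔼 → ℝ) :
    sumBiLap f = ∑ i, ∑ j, iterPartial [j, j, i, i] f := by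
  funext x
  simp [sumBiLap]

theorem iterPartial_sumBiLap {f : 𝔼 → ℝ} (hf : ContDiff ℝ ∞ f) (L : List (Fin n)) :
    iterPartial L (sumBiLap f) = ∑ i, ∑ j, iterPartial ([j, j, i, i] ++ L) f := by
  rw [sumBiLap_eq_sum, iterPartial_sum]
  · refine Finset.sum_congr rfl fun i _ => ?_
    rw [iterPartial_sum]
    · simp only [iterPartial_append]
    · exact fun j => contDiff_iterPartial hf _
  · intro i
    have : ContDiff ℝ ∞ (fun x => ∑ j, iterPartial [j, j, i, i] f x) :=
      ContDiff.sum fun j _ => contDiff_iterPartial hf _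
    convert this using 1
    funext x
    simp

theorem partialDeriv_sumBiLap {f : 𝔼 → ℝ} (hf : ContDiff ℝ ∞ f) (j : Fin n) :
    partialDeriv j (sumBiLap f) = sumBiLap (partialDeriv j f) := by
  have := iterPartial_sumBiLap hf [j]
  change partialDeriv j (sumBiLap f) = _ at this
  rw [this, sumBiLap_eq_sum]
  refine Finset.sum_congr rfl fun i _ => Finset.sum_congr rfl fun k _ => ?_
  rw [iterPartial_partialDeriv hf, iterPartial_append]
  rfl

theorem partialDeriv_mul {f g : 𝔼 → ℝ} (hf : ContDiff ℝ ∞ f) (hg : ContDiff ℝ ∞ g)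
    (j : Fin n) : partialDeriv j (f * g) = partialDeriv j f * g + f * partialDeriv j g := by
  funext x
  simp [partialDeriv, fderiv_mul (hf.differentiable (by simp) x) (hg.differentiable (by simp) x)]
  ring

/-- Crude Leibniz bound: the derivatives of a product are controlled by the derivatives of the
factors at the same point. -/
theorem abs_iterPartial_mul_le {f g : 𝔼 → ℝ} (hf : ContDiff ℝ ∞ f) (hg : ContDiff ℝ ∞ g)
    {A B : ℝ} (hA : 0 ≤ A) (x : 𝔼) (L : List (Fin n))
    (hfA : ∀ M : List (Fin n), M.length ≤ L.length → |iterPartial M f x| ≤ A)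
    (hgB : ∀ M : List (Fin n), M.length ≤ L.length → |iterPartial M g x| ≤ B) :
    |iterPartial L (f * g) x| ≤ 2 ^ L.length * (A * B) := by
  induction L generalizing f g with
  | nil =>
    have h1 := hfA [] le_rfl
    have h2 := hgB [] le_rfl
    simp only [iterPartial, Pi.mul_apply, abs_mul, List.length_nil, pow_zero, one_mul] at *
    exact mul_le_mul h1 h2 (abs_nonneg _) hA
  | cons j L ih =>
    have hf' := contDiff_partialDeriv hf j
    have hg' := contDiff_partialDeriv hg j
    simp only [iterPartial, partialDeriv_mul hf hg]
    have hs1 : ContDiff ℝ ∞ (partialDeriv j f * g) := hf'.mul hg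
    have hs2 : ContDiff ℝ ∞ (f * partialDeriv j g) := hf.mul hg'
    rw [iterPartial_add hs1 hs2]
    have h1 := ih hf' hg
      (fun M hM => hfA (j :: M) (by simpa using hM))
      (fun M hM => hgB M (by simp; omega))
    have h2 := ih hf hg'
      (fun M hM => hfA M (by simp; omega))
      (fun M hM => hgB (j :: M) (by simpa using hM))
    calc |(iterPartial L (partialDeriv j f * g) + iterPartial L (f * partialDeriv j g)) x|
        ≤ |iterPartial L (partialDeriv j f * g) x| + |iterPartial L (f * partialDeriv j g) x| :=
          abs_add_le _ _
      _ ≤ 2 ^ (j :: L).length * (A * B) := by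
          rw [List.length_cons, pow_succ]; linarith

theorem partialDeriv_comp_affine (f : 𝔼 → ℝ) (hf : ContDiff ℝ ∞ f) (a : 𝔼) (c : ℝ) (j : Fin n) :
    partialDeriv j (fun y => f (a + c • y)) = fun y => c * partialDeriv j f (a + c • y) := by
  funext x
  have h1 : HasFDerivAt (fun y : 𝔼 => a + c • y) (c • ContinuousLinearMap.id ℝ 𝔼) x :=
    ((hasFDerivAt_id x).const_smul c).const_add a
  have h2 := (hf.differentiable (by simp) (a + c • x)).hasFDerivAt.comp x h1
  have h3 : fderiv ℝ (fun y => f (a + c • y)) x = _ := h2.fderiv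
  simp [partialDeriv, h3]

theorem iterPartial_comp_affine {f : 𝔼 → ℝ} (hf : ContDiff ℝ ∞ f) (a : 𝔼) (c : ℝ)
    (L : List (Fin n)) :
    iterPartial L (fun y => f (a + c • y)) =
      fun y => c ^ L.length * iterPartial L f (a + c • y) := by
  induction L generalizing f with
  | nil => simp [iterPartial]
  | cons j L ih =>
    simp only [iterPartial, partialDeriv_comp_affine f hf]
    have := iterPartial_const_smul c (fun y => partialDeriv j f (a + c • y)) L
    change iterPartial L (fun y => c * partialDeriv j f (a + c • y)) = _ at this
    rw [this, ih (contDiff_partialDeriv hf j)]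
    funext y
    simp [pow_succ]; ring

theorem sumBiLap_comp_affine {f : 𝔼 → ℝ} (hf : ContDiff ℝ ∞ f) (a : 𝔼) (c : ℝ) :
    sumBiLap (fun y => f (a + c • y)) = fun y => c ^ 4 * sumBiLap f (a + c • y) := by
  funext y
  simp [sumBiLap, iterPartial_comp_affine hf, Finset.mul_sum]

theorem partialDeriv_eventuallyEq {f g : 𝔼 → ℝ} {x : 𝔼} (h : f =ᶠ[nhds x] g) (j : Fin n) :
    partialDeriv j f =ᶠ[nhds x] partialDeriv j g := by
  filter_upwards [h.eventuallyEq_nhds] with y hy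
  simp [partialDeriv, hy.fderiv_eq]

theorem iterPartial_eventuallyEq {f g : 𝔼 → ℝ} {x : 𝔼} (h : f =ᶠ[nhds x] g)
    (L : List (Fin n)) : iterPartial L f =ᶠ[nhds x] iterPartial L g := by
  induction L generalizing f g with
  | nil => exact h
  | cons j L ih => exact ih (partialDeriv_eventuallyEq h j)

theorem sumBiLap_eventuallyEq {f g : 𝔼 → ℝ} {x : 𝔼} (h : f =ᶠ[nhds x] g) :
    sumBiLap f =ᶠ[nhds x] sumBiLap g := by
  have : ∀ᶠ y in nhds x, ∀ i j, iterPartial [j, j, i, i] f y = iterPartial [j, j, i, i] g y :=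
    Filter.eventually_all.2 fun i => Filter.eventually_all.2 fun j =>
      iterPartial_eventuallyEq h [j, j, i, i]
  filter_upwards [this] with y hy
  simp [sumBiLap, hy]

theorem tsupport_iterPartial_subset (f : 𝔼 → ℝ) (L : List (Fin n)) :
    tsupport (iterPartial L f) ⊆ tsupport f := by
  intro x hx
  by_contra hx'
  rw [notMem_tsupport_iff_eventuallyEq] at hx'
  have h := iterPartial_eventuallyEq hx' L
  rw [iterPartial_zero] at h
  exact (notMem_tsupport_iff_eventuallyEq.2 h) hx

theorem iteratedFDeriv_single_eq_iterPartial {f : 𝔼 → ℝ} (hf : ContDiff ℝ ∞ f) {i : ℕ}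
    (J : Fin i → Fin n) (x : 𝔼) :
    iteratedFDeriv ℝ i f x (fun a => EuclideanSpace.single (J a) (1 : ℝ)) =
      iterPartial (List.ofFn J) f x := by
  induction i generalizing x with
  | zero => simp [iterPartial]
  | succ i ih =>
    have hd : DifferentiableAt ℝ (iteratedFDeriv ℝ i f) x :=
      hf.differentiable_iteratedFDeriv (by exact_mod_cast ENat.natCast_lt_top i) x
    rw [List.ofFn_succ, iterPartial, iterPartial_partialDeriv hf, iteratedFDeriv_succ_apply_left]
    have h2 : iterPartial (List.ofFn fun a => J a.succ) f = fun y =>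
        iteratedFDeriv ℝ i f y (fun a => EuclideanSpace.single (J a.succ) (1 : ℝ)) := by
      funext y
      exact (ih (fun a => J a.succ) y).symm
    rw [h2, partialDeriv, fderiv_continuousMultilinear_apply_const hd]
    rfl

theorem biLaplacian_eq_sumBiLap {f : 𝔼 → ℝ} (hf : ContDiff ℝ ∞ f) :
    biLaplacian f = sumBiLap f := by
  have key : ∀ {g : 𝔼 → ℝ}, ContDiff ℝ ∞ g →
      Laplacian.laplacian g = ∑ i, iterPartial [i, i] g := by
    intro g hg
    rw [InnerProductSpace.laplacian_eq_iteratedFDeriv_orthonormalBasis g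
      (EuclideanSpace.basisFun (Fin n) ℝ)]
    funext x
    rw [Finset.sum_apply]
    refine Finset.sum_congr rfl fun i _ => ?_
    have := iteratedFDeriv_single_eq_iterPartial hg ![i, i] x
    have hl : List.ofFn ![i, i] = [i, i] := by simp
    rw [hl] at this
    simp only [EuclideanSpace.basisFun_apply]
    rw [← this]
    congr 1
    funext a
    fin_cases a <;> rfl
  have hs : ContDiff ℝ ∞ (∑ i, iterPartial [i, i] f) := by
    have : ContDiff ℝ ∞ (fun x => ∑ i, iterPartial [i, i] f x) :=
      ContDiff.sum fun j _ => contDiff_iterPartial hf _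
    convert this using 1
    funext x
    simp
  rw [biLaplacian, key hf, key hs, sumBiLap_eq_sum]
  refine Finset.sum_congr rfl fun i _ => ?_
  rw [iterPartial_sum _ (fun j => contDiff_iterPartial hf _)]
  rfl

theorem integral_mul_partialDeriv {f g : 𝔼 → ℝ} (hf : ContDiff ℝ ∞ f) (hg : ContDiff ℝ ∞ g)
    (hgs : HasCompactSupport g) (j : Fin n) :
    ∫ x, f x * partialDeriv j g x = - ∫ x, partialDeriv j f x * g x := by
  have hgs' : HasCompactSupport (partialDeriv j g) :=
    hgs.of_isClosed_subset (isClosed_tsupport _) (tsupport_iterPartial_subset g [j])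
  refine integral_mul_fderiv_eq_neg_fderiv_mul_of_integrable ?_ ?_ ?_
    (fun x _ => hf.differentiable (by simp) x) (fun x _ => hg.differentiable (by simp) x)
  · exact ((contDiff_partialDeriv hf j).continuous.mul
      hg.continuous).integrable_of_hasCompactSupport hgs.mul_left
  · exact (hf.continuous.mul
      (contDiff_partialDeriv hg j).continuous).integrable_of_hasCompactSupport hgs'.mul_left
  · exact (hf.continuous.mul hg.continuous).integrable_of_hasCompactSupport hgs.mul_left

theorem integral_mul_iterPartial {f g : 𝔼 → ℝ} (hf : ContDiff ℝ ∞ f) (hg : ContDiff ℝ ∞ g)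
    (hgs : HasCompactSupport g) (L : List (Fin n)) :
    ∫ x, f x * iterPartial L g x = (-1) ^ L.length * ∫ x, iterPartial L f x * g x := by
  induction L generalizing f g with
  | nil => simp [iterPartial]
  | cons j L ih =>
    have hgs' : HasCompactSupport (partialDeriv j g) :=
      hgs.of_isClosed_subset (isClosed_tsupport _) (tsupport_iterPartial_subset g [j])
    rw [iterPartial, ih hf (contDiff_partialDeriv hg j) hgs',
      integral_mul_partialDeriv (contDiff_iterPartial hf L) hg hgs,
      ← iterPartial_partialDeriv hf, iterPartial, List.length_cons, pow_succ]
    ring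

theorem integral_mul_sumBiLap {f g : 𝔼 → ℝ} (hf : ContDiff ℝ ∞ f) (hg : ContDiff ℝ ∞ g)
    (hgs : HasCompactSupport g) :
    ∫ x, f x * sumBiLap g x = ∫ x, sumBiLap f x * g x := by
  have hsupp : ∀ L : List (Fin n), HasCompactSupport (iterPartial L g) := fun L =>
    hgs.of_isClosed_subset (isClosed_tsupport _) (tsupport_iterPartial_subset g L)
  have hI1 : ∀ i j, MeasureTheory.Integrable fun x => f x * iterPartial [j, j, i, i] g x :=
    fun i j => (hf.continuous.mul
      (contDiff_iterPartial hg _).continuous).integrable_of_hasCompactSupport (hsupp _).mul_left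
  have hI2 : ∀ i j, MeasureTheory.Integrable fun x => iterPartial [j, j, i, i] f x * g x :=
    fun i j => ((contDiff_iterPartial hf _).continuous.mul
      hg.continuous).integrable_of_hasCompactSupport hgs.mul_left
  simp only [sumBiLap, Finset.mul_sum, Finset.sum_mul]
  rw [MeasureTheory.integral_finsetSum _ fun i _ => MeasureTheory.integrable_finsetSum _
      fun j _ => hI1 i j,
    MeasureTheory.integral_finsetSum _ fun i _ => MeasureTheory.integrable_finsetSum _
      fun j _ => hI2 i j]
  refine Finset.sum_congr rfl fun i _ => ?_
  rw [MeasureTheory.integral_finsetSum _ fun j _ => hI1 i j,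
    MeasureTheory.integral_finsetSum _ fun j _ => hI2 i j]
  refine Finset.sum_congr rfl fun j _ => ?_
  rw [integral_mul_iterPartial hf hg hgs, show [j, j, i, i].length = 4 from rfl]
  norm_num

end PartialDerivatives

/-! ### The profile of the biharmonic heat kernel -/

section Kernel

open MeasureTheory SchwartzMap FourierTransform LineDeriv Laplacian Real
open scoped SchwartzMap Nat

variable {n : ℕ}

local notation "𝔼" => EuclideanSpace ℝ (Fin n)

/-- The Schwartz function `exp (-c ‖ξ‖⁴)`, the Fourier transform of the biharmonic heat kernel
at time one when `c = (2π)⁴`. -/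
noncomputable def expNegQuartic (n : ℕ) (c : ℝ) (hc : 0 < c) :
    𝓢(EuclideanSpace ℝ (Fin n), ℝ) where
  toFun ξ := Real.exp (-(c * (‖ξ‖ ^ 2) ^ 2))
  smooth' := by
    have : ContDiff ℝ ∞ fun ξ : EuclideanSpace ℝ (Fin n) => ‖ξ‖ ^ 2 := contDiff_norm_sq ℝ
    exact (contDiff_const.mul (this.pow 2)).neg.exp
  decay' k m := by
    set f : EuclideanSpace ℝ (Fin n) → ℝ := fun ξ => -(c * (‖ξ‖ ^ 2) ^ 2) with hf
    have hft : f.HasTemperateGrowth := by fun_prop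
    obtain ⟨k₁, C₁, hC₁, h₁⟩ := hft.norm_iteratedFDeriv_le_uniform m
    -- any power of `1 + ‖ξ‖` is absorbed by the exponential
    obtain ⟨M, hM⟩ : ∃ M : ℝ, ∀ r : ℝ, 0 ≤ r →
        (1 + r) ^ (k + k₁ * m) * Real.exp (-(c * (r ^ 2) ^ 2)) ≤ M := by
      set N := k + k₁ * m
      refine ⟨Real.exp (2 + 1 / c) * N !, fun r hr => ?_⟩
      have hlin : r ≤ c * (r ^ 2) ^ 2 + (1 + 1 / c) := by
        have hc' : 0 < 1 / c := by positivity
        rcases le_total r (1 + 1 / c) with h | h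
        · have : 0 ≤ c * (r ^ 2) ^ 2 := by positivity
          linarith
        · have hr1 : 1 ≤ r := by linarith
          have h1 : 1 ≤ c * r := by
            have : c * (1 + 1 / c) ≤ c * r := by gcongr
            have h2 : c * (1 + 1 / c) = c + 1 := by field_simp
            linarith
          have h2 : r ≤ r ^ 3 := le_self_pow₀ hr1 (by norm_num)
          have h3 : c * (r ^ 2) ^ 2 = c * r * r ^ 3 := by ring
          have h4 : 1 * r ^ 3 ≤ c * r * r ^ 3 := by gcongr
          linarith
      have h1 : (1 + r) ^ N ≤ N ! * Real.exp (1 + r) := by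
        have := Real.pow_div_factorial_le_exp (x := 1 + r) (by linarith) N
        rw [div_le_iff₀ (by positivity)] at this
        linarith
      calc (1 + r) ^ N * Real.exp (-(c * (r ^ 2) ^ 2))
          ≤ N ! * Real.exp (1 + r) * Real.exp (-(c * (r ^ 2) ^ 2)) := by gcongr
        _ = N ! * Real.exp (1 + r + -(c * (r ^ 2) ^ 2)) := by rw [mul_assoc, ← Real.exp_add]
        _ ≤ N ! * Real.exp (2 + 1 / c) :=
          mul_le_mul_of_nonneg_left (Real.exp_le_exp.2 (by linarith)) (by positivity)
        _ = _ := by ring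
    refine ⟨m ! * (1 + C₁) ^ m * M, fun ξ => ?_⟩
    have h2 : ‖iteratedFDeriv ℝ m (Real.exp ∘ f) ξ‖ ≤
        m ! * Real.exp (f ξ) * ((1 + C₁) * (1 + ‖ξ‖) ^ k₁) ^ m := by
      refine norm_iteratedFDeriv_comp_le (N := ∞) Real.contDiff_exp hft.1 (by exact_mod_cast le_top)
        ξ ?_ ?_
      · intro i _
        rw [norm_iteratedFDeriv_eq_norm_iteratedDeriv, iteratedDeriv_eq_iterate,
          Real.iter_deriv_exp]
        simp
      · intro i hi1 hi2
        have h1 : (1 : ℝ) ≤ (1 + C₁) * (1 + ‖ξ‖) ^ k₁ :=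
          one_le_mul_of_one_le_of_one_le (by linarith)
            (one_le_pow₀ (by linarith [norm_nonneg ξ]))
        calc ‖iteratedFDeriv ℝ i f ξ‖ ≤ C₁ * (1 + ‖ξ‖) ^ k₁ := h₁ i hi2 ξ
          _ ≤ (1 + C₁) * (1 + ‖ξ‖) ^ k₁ := by gcongr; linarith
          _ ≤ _ := le_self_pow₀ h1 (by omega)
    have h3 : ‖ξ‖ ^ k ≤ (1 + ‖ξ‖) ^ k := by gcongr; linarith
    calc ‖ξ‖ ^ k * ‖iteratedFDeriv ℝ m (Real.exp ∘ f) ξ‖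
        ≤ (1 + ‖ξ‖) ^ k * (m ! * Real.exp (f ξ) * ((1 + C₁) * (1 + ‖ξ‖) ^ k₁) ^ m) := by gcongr
      _ = m ! * (1 + C₁) ^ m *
          ((1 + ‖ξ‖) ^ (k + k₁ * m) * Real.exp (-(c * (‖ξ‖ ^ 2) ^ 2))) := by
          rw [mul_pow, pow_add, pow_mul]; simp only [hf]; ring
      _ ≤ m ! * (1 + C₁) ^ m * M := by
          gcongr
          exact hM _ (norm_nonneg _)

theorem expNegQuartic_apply (c : ℝ) (hc : 0 < c) (ξ : 𝔼) :
    expNegQuartic n c hc ξ = Real.exp (-(c * (‖ξ‖ ^ 2) ^ 2)) := rfl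

/-- The radial derivative of `exp (-c ‖ξ‖⁴)`. -/
theorem fderiv_expNegQuartic_self (c : ℝ) (hc : 0 < c) (ξ : 𝔼) :
    fderiv ℝ (expNegQuartic n c hc) ξ ξ =
      -(4 * c * (‖ξ‖ ^ 2) ^ 2 * expNegQuartic n c hc ξ) := by
  have h1 : HasFDerivAt (fun ξ : 𝔼 => ‖ξ‖ ^ 2) (2 • innerSL ℝ ξ) ξ :=
    (hasStrictFDerivAt_norm_sq ξ).hasFDerivAt
  have h2 := ((h1.pow 2).const_mul c).neg.exp
  have h3 : fderiv ℝ (expNegQuartic n c hc) ξ = _ := h2.fderiv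
  rw [h3, expNegQuartic_apply]
  simp
  ring

/-- On the Fourier side, `div (x K)` is the transform of minus the radial derivative. -/
theorem sum_lineDeriv_coord_smul_fourierInv (f : 𝓢(𝔼, ℂ)) :
    ∑ i : Fin n, ∂_{(EuclideanSpace.single i (1 : ℝ) : 𝔼)}
        (smulLeftCLM ℂ (inner ℝ · (EuclideanSpace.single i (1 : ℝ) : 𝔼)) (𝓕⁻ f)) =
      𝓕⁻ (-∑ i : Fin n, smulLeftCLM ℂ (inner ℝ · (EuclideanSpace.single i (1 : ℝ) : 𝔼))
        (∂_{(EuclideanSpace.single i (1 : ℝ) : 𝔼)} f)) := by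
  have h : ∀ i : Fin n, smulLeftCLM ℂ (inner ℝ · (EuclideanSpace.single i (1 : ℝ) : 𝔼)) (𝓕⁻ f) =
      (-(2 * π * Complex.I))⁻¹ • 𝓕⁻ (∂_{(EuclideanSpace.single i (1 : ℝ) : 𝔼)} f) := by
    intro i
    rw [fourierInv_lineDerivOp_eq, smul_smul, inv_mul_cancel₀, one_smul]
    simp [pi_ne_zero]
  have h2 : (-(2 * π * Complex.I))⁻¹ * (2 * π * Complex.I) = -1 := by
    rw [inv_neg, neg_mul, inv_mul_cancel₀]
    simp [pi_ne_zero]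
  rw [← Finset.sum_neg_distrib, fourierInv_sum]
  refine Finset.sum_congr rfl fun i _ => ?_
  rw [h, lineDerivOp_smul, lineDerivOp_fourierInv_eq, FourierTransform.fourierInv_smul, smul_smul,
    h2, fourierInv_neg, neg_smul, one_smul]

theorem laplacian_laplacian_fourierInv (f : 𝓢(𝔼, ℂ)) :
    Δ (Δ (𝓕⁻ f)) = 𝓕⁻ ((2 * π) ^ 4 • smulLeftCLM ℂ (fun ξ : 𝔼 => ‖ξ‖ ^ 2)
      (smulLeftCLM ℂ (fun ξ : 𝔼 => ‖ξ‖ ^ 2) f)) := by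
  have key : ∀ g : 𝓢(𝔼, ℂ), Δ (𝓕⁻ g) =
      (-(2 * π) ^ 2) • 𝓕⁻ (smulLeftCLM ℂ (fun ξ : 𝔼 => ‖ξ‖ ^ 2) g) := by
    intro g
    rw [laplacian_eq_fourierMultiplierCLM (𝓕⁻ g), fourierMultiplierCLM_apply,
      FourierTransform.fourier_fourierInv_eq]
  have hsm : ∀ (a : ℝ) (g : 𝓢(𝔼, ℂ)), 𝓕⁻ (a • g) = a • 𝓕⁻ g := fun a g =>
    FourierTransform.fourierInv_smul a g
  rw [key, ← hsm, key, map_smul, hsm, hsm, smul_smul]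
  congr 1
  ring

/-- The real part of a complex Schwartz function. -/
noncomputable def schwartzRe (f : 𝓢(𝔼, ℂ)) : 𝓢(𝔼, ℝ) :=
  postcompCLM (𝕜 := ℝ) Complex.reCLM f

theorem schwartzRe_apply (f : 𝓢(𝔼, ℂ)) (x : 𝔼) : schwartzRe f x = (f x).re := rfl

theorem partialDeriv_schwartzRe (f : 𝓢(𝔼, ℂ)) (j : Fin n) :
    partialDeriv j (schwartzRe f) =
      schwartzRe (∂_{(EuclideanSpace.single j (1 : ℝ) : 𝔼)} f) := by
  funext x
  have h : HasFDerivAt (schwartzRe f) _ x :=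
    Complex.reCLM.hasFDerivAt.comp x (f.differentiableAt (x := x)).hasFDerivAt
  simp [partialDeriv, h.fderiv, schwartzRe_apply, lineDerivOp_apply_eq_fderiv]

theorem sumBiLap_schwartzRe (f : 𝓢(𝔼, ℂ)) : sumBiLap (schwartzRe f) = schwartzRe (Δ (Δ f)) := by
  funext x
  rw [schwartzRe_apply, laplacian_eq_sum (EuclideanSpace.basisFun (Fin n) ℝ),
    laplacian_eq_sum (EuclideanSpace.basisFun (Fin n) ℝ)]
  simp only [sumBiLap, iterPartial, partialDeriv_schwartzRe, EuclideanSpace.basisFun_apply,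
    lineDerivOp_sum, sum_apply, Complex.re_sum, schwartzRe_apply]

theorem sum_coord_mul_apply_single (A : 𝔼 →L[ℝ] ℝ) (x : 𝔼) :
    ∑ i, x i * A (EuclideanSpace.single i 1) = A x := by
  have hx : x = ∑ i, x i • (EuclideanSpace.single i (1 : ℝ) : 𝔼) := by
    ext j
    simp [Pi.single_apply]
  conv_rhs => rw [hx]
  simp [map_sum]

/-- The profile at time one of the biharmonic heat kernel: a Schwartz function with integral one
such that `t ^ (-n / 4) K (x / t ^ (1 / 4))` solves the biharmonic heat equation. -/
theorem exists_biharmonic_heat_profile (n : ℕ) :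
    ∃ K : 𝓢(EuclideanSpace ℝ (Fin n), ℝ), ∫ z, K z = 1 ∧
      ∀ z, 4 * sumBiLap K z = n * K z + fderiv ℝ K z z := by
  have hc : (0 : ℝ) < (2 * π) ^ 4 := by positivity
  set g := expNegQuartic n _ hc with hg
  set G : 𝓢(EuclideanSpace ℝ (Fin n), ℂ) := postcompCLM (𝕜 := ℝ) Complex.ofRealCLM g with hG
  have hGapp : ∀ ξ, G ξ = (g ξ : ℂ) := fun ξ => rfl
  have hGd : ∀ ξ v, (∂_{v} G : 𝓢(EuclideanSpace ℝ (Fin n), ℂ)) ξ = ((fderiv ℝ g ξ v : ℝ) : ℂ) := by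
    intro ξ v
    have h : HasFDerivAt G _ ξ :=
      Complex.ofRealCLM.hasFDerivAt.comp ξ (g.differentiableAt (x := ξ)).hasFDerivAt
    simp [lineDerivOp_apply_eq_fderiv, h.fderiv]
  -- Euler's identity on the Fourier side
  have hfour : (4 : ℝ) • ((2 * π) ^ 4 • smulLeftCLM ℂ (fun ξ : EuclideanSpace ℝ (Fin n) => ‖ξ‖ ^ 2)
      (smulLeftCLM ℂ (fun ξ : EuclideanSpace ℝ (Fin n) => ‖ξ‖ ^ 2) G)) =
      -∑ i : Fin n, smulLeftCLM ℂ
        (inner ℝ · (EuclideanSpace.single i (1 : ℝ) : EuclideanSpace ℝ (Fin n)))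
        (∂_{(EuclideanSpace.single i (1 : ℝ) : EuclideanSpace ℝ (Fin n))} G) := by
    ext ξ
    have h1 : ∑ i, ξ i * fderiv ℝ g ξ (EuclideanSpace.single i 1) = fderiv ℝ g ξ ξ :=
      sum_coord_mul_apply_single _ ξ
    rw [fderiv_expNegQuartic_self] at h1
    have hin : ∀ i : Fin n, Function.HasTemperateGrowth
        (inner ℝ · (EuclideanSpace.single i (1 : ℝ) : EuclideanSpace ℝ (Fin n))) :=
      fun i => by fun_prop
    have hnt : Function.HasTemperateGrowth (fun ξ : EuclideanSpace ℝ (Fin n) => ‖ξ‖ ^ 2) := by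
      fun_prop
    simp only [smul_apply, neg_apply, sum_apply,
      smulLeftCLM_apply_apply hnt, smulLeftCLM_apply_apply (hin _), hGapp, hGd]
    have h2 : ∀ i : Fin n, inner ℝ ξ (EuclideanSpace.single i (1 : ℝ)) = ξ i := by
      intro i; simp [EuclideanSpace.inner_single_right]
    simp only [h2, Complex.real_smul]
    have h3 := congrArg (fun r : ℝ => (r : ℂ)) h1
    push_cast at h3 ⊢
    rw [h3]
    ring
  refine ⟨schwartzRe (𝓕⁻ G), ?_, fun z => ?_⟩
  · have h1 : ∫ z, (𝓕⁻ G) z = 1 := by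
      have h2 : 𝓕 (𝓕⁻ G) 0 = G 0 := by rw [FourierTransform.fourier_fourierInv_eq]
      rw [fourier_coe, Real.fourier_eq] at h2
      simpa [hGapp, hg, expNegQuartic_apply] using h2
    simp only [schwartzRe_apply]
    have h3 := integral_re (𝕜 := ℂ) (𝓕⁻ G).integrable (μ := volume)
    rw [h1] at h3
    simpa using h3
  · have h4 : (4 : ℝ) • Δ (Δ (𝓕⁻ G)) =
        ∑ i : Fin n, ∂_{(EuclideanSpace.single i (1 : ℝ) : EuclideanSpace ℝ (Fin n))}
        (smulLeftCLM ℂ (inner ℝ · (EuclideanSpace.single i (1 : ℝ) : EuclideanSpace ℝ (Fin n)))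
          (𝓕⁻ G)) := by
      rw [sum_lineDeriv_coord_smul_fourierInv, ← hfour, laplacian_laplacian_fourierInv]
      exact (FourierTransform.fourierInv_smul (4 : ℝ) _).symm
    have h5 := congrArg (fun f : 𝓢(EuclideanSpace ℝ (Fin n), ℂ) => (f z).re) h4
    simp only [smul_apply, sum_apply, Complex.re_sum, Complex.real_smul,
      Complex.re_ofReal_mul] at h5
    rw [sumBiLap_schwartzRe, schwartzRe_apply, h5]
    have h6 : ∀ i : Fin n, (∂_{(EuclideanSpace.single i (1 : ℝ) : EuclideanSpace ℝ (Fin n))}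
        (smulLeftCLM ℂ (inner ℝ · (EuclideanSpace.single i (1 : ℝ) : EuclideanSpace ℝ (Fin n)))
          (𝓕⁻ G)) z).re = schwartzRe (𝓕⁻ G) z +
          z i * fderiv ℝ (schwartzRe (𝓕⁻ G)) z (EuclideanSpace.single i 1) := by
      intro i
      have hfun : schwartzRe (smulLeftCLM ℂ
          (inner ℝ · (EuclideanSpace.single i (1 : ℝ) : EuclideanSpace ℝ (Fin n))) (𝓕⁻ G)) =
          fun z : EuclideanSpace ℝ (Fin n) => z i * schwartzRe (𝓕⁻ G) z := by
        funext w
        rw [schwartzRe_apply, smulLeftCLM_apply_apply (by fun_prop), schwartzRe_apply,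
          Complex.real_smul, Complex.re_ofReal_mul]
        simp [EuclideanSpace.inner_single_right]
      have hd : HasFDerivAt (fun z : EuclideanSpace ℝ (Fin n) => z i)
          (EuclideanSpace.proj i : EuclideanSpace ℝ (Fin n) →L[ℝ] ℝ) z :=
        (EuclideanSpace.proj i : EuclideanSpace ℝ (Fin n) →L[ℝ] ℝ).hasFDerivAt
      have hd2 := hd.fun_mul ((schwartzRe (𝓕⁻ G)).differentiableAt (x := z)).hasFDerivAt
      rw [← schwartzRe_apply, ← partialDeriv_schwartzRe, hfun, partialDeriv, hd2.fderiv]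
      simp
      ring
    rw [Finset.sum_congr rfl fun i _ => h6 i, Finset.sum_add_distrib,
      sum_coord_mul_apply_single]
    simp

end Kernel

/-! ### Solutions of the biharmonic heat equation -/

section Solutions

open Set

variable {n : ℕ}

local notation "𝔼" => EuclideanSpace ℝ (Fin n)

/-- Functions smooth on `ℝⁿ × [0, T]` that solve `∂ₜ f = -Δ² f` at the interior times. -/
structure SolvesBiharmonic (T : ℝ) (f : 𝔼 → ℝ → ℝ) : Prop where
  smooth : ContDiffOn ℝ ∞ (fun p : 𝔼 × ℝ => f p.1 p.2) (univ ×ˢ Icc 0 T)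
  equation : ∀ x, ∀ t ∈ Ioo 0 T, HasDerivAt (fun τ => f x τ) (-sumBiLap (fun y => f y t) x) t

theorem contDiff_slice {T : ℝ} {f : 𝔼 → ℝ → ℝ}
    (hf : ContDiffOn ℝ ∞ (fun p : 𝔼 × ℝ => f p.1 p.2) (univ ×ˢ Icc 0 T)) {t : ℝ}
    (ht : t ∈ Icc 0 T) : ContDiff ℝ ∞ fun y => f y t := by
  rw [← contDiffOn_univ]
  have h : ContDiffOn ℝ ∞ (fun y : 𝔼 => (y, t)) univ :=
    (contDiff_id.prodMk contDiff_const).contDiffOn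
  exact hf.comp h fun y _ => ⟨mem_univ _, ht⟩

theorem fderiv_slice {f : 𝔼 → ℝ → ℝ} {s : Set ℝ} {A : 𝔼 × ℝ →L[ℝ] ℝ} {x : 𝔼} {t : ℝ}
    (ht : t ∈ s) (hA : HasFDerivWithinAt (fun p : 𝔼 × ℝ => f p.1 p.2) A (univ ×ˢ s) (x, t))
    (j : Fin n) :
    partialDeriv j (fun y => f y t) x = A (EuclideanSpace.single j 1, 0) := by
  have h : HasFDerivWithinAt (fun y : 𝔼 => (y, t)) (ContinuousLinearMap.inl ℝ 𝔼 ℝ) univ x :=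
    (hasFDerivAt_prodMk_left x t).hasFDerivWithinAt
  have hm : MapsTo (fun y : 𝔼 => (y, t)) univ (univ ×ˢ s) := fun y _ => ⟨mem_univ _, ht⟩
  have h2 := HasFDerivWithinAt.comp x hA h hm
  rw [hasFDerivWithinAt_univ] at h2
  have h3 : fderiv ℝ (fun y => f y t) x = _ := h2.fderiv
  simp [partialDeriv, h3]

theorem contDiffOn_partialDeriv_slice {T : ℝ} (hT : 0 < T) {f : 𝔼 → ℝ → ℝ}
    (hf : ContDiffOn ℝ ∞ (fun p : 𝔼 × ℝ => f p.1 p.2) (univ ×ˢ Icc 0 T)) (j : Fin n) :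
    ContDiffOn ℝ ∞ (fun p : 𝔼 × ℝ => partialDeriv j (fun y => f y p.2) p.1)
      (univ ×ˢ Icc 0 T) := by
  have hu : UniqueDiffOn ℝ ((univ : Set 𝔼) ×ˢ Icc 0 T) :=
    uniqueDiffOn_univ.prod (uniqueDiffOn_Icc hT)
  have h := (hf.fderivWithin hu (m := ∞) (by simp)).clm_apply
    (contDiffOn_const (c := ((EuclideanSpace.single j 1, 0) : 𝔼 × ℝ)))
  refine h.congr fun p hp => ?_
  exact fderiv_slice hp.2 ((hf.differentiableOn (by simp)) p hp).hasFDerivWithinAt j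

/-- Spatial derivatives of solutions are solutions: time and space derivatives commute. -/
theorem SolvesBiharmonic.partialDeriv {T : ℝ} (hT : 0 < T) {f : 𝔼 → ℝ → ℝ}
    (hf : SolvesBiharmonic T f) (j : Fin n) :
    SolvesBiharmonic T fun x t => partialDeriv j (fun y => f y t) x := by
  refine ⟨contDiffOn_partialDeriv_slice hT hf.smooth j, fun x t ht => ?_⟩
  set F : 𝔼 × ℝ → ℝ := fun p => f p.1 p.2 with hF
  have hnhds : ∀ y : 𝔼, ∀ τ ∈ Ioo 0 T, (univ : Set 𝔼) ×ˢ Icc 0 T ∈ nhds (y, τ) := fun y τ hτ =>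
    prod_mem_nhds Filter.univ_mem (Icc_mem_nhds hτ.1 hτ.2)
  have hFs : ∀ y : 𝔼, ∀ τ ∈ Ioo 0 T, ContDiffAt ℝ ∞ F (y, τ) := fun y τ hτ =>
    hf.smooth.contDiffAt (hnhds y τ hτ)
  have hFd : ∀ y : 𝔼, ∀ τ ∈ Ioo 0 T, HasFDerivAt F (fderiv ℝ F (y, τ)) (y, τ) := fun y τ hτ =>
    ((hFs y τ hτ).differentiableAt (by simp)).hasFDerivAt
  have hspace : ∀ y : 𝔼, ∀ τ ∈ Ioo 0 T, _root_.partialDeriv j (fun y => f y τ) y =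
      fderiv ℝ F (y, τ) (EuclideanSpace.single j 1, 0) := fun y τ hτ =>
    fderiv_slice (s := univ) (mem_univ _) (hFd y τ hτ).hasFDerivWithinAt j
  have htime : ∀ y : 𝔼, ∀ τ ∈ Ioo 0 T,
      -sumBiLap (fun y => f y τ) y = fderiv ℝ F (y, τ) (0, 1) := by
    intro y τ hτ
    have h1 : HasDerivAt (fun τ : ℝ => (y, τ)) ((0 : 𝔼), (1 : ℝ)) τ :=
      (hasDerivAt_const τ y).prodMk (hasDerivAt_id τ)
    exact (hf.equation y τ hτ).unique ((hFd y τ hτ).comp_hasDerivAt τ h1)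
  have hF2 : HasFDerivAt (fderiv ℝ F) (fderiv ℝ (fderiv ℝ F) (x, t)) (x, t) :=
    (((hFs x t ht).fderiv_right (m := ∞) (by simp)).differentiableAt (by simp)).hasFDerivAt
  have hsymm : IsSymmSndFDerivAt ℝ F (x, t) :=
    (contDiffAt_infty.1 (hFs x t ht) 2).isSymmSndFDerivAt (by simp)
  have hval : -sumBiLap (_root_.partialDeriv j fun y => f y t) x =
      fderiv ℝ (fderiv ℝ F) (x, t) (0, 1) (EuclideanSpace.single j 1, 0) := by
    rw [← partialDeriv_sumBiLap (contDiff_slice hf.smooth (Ioo_subset_Icc_self ht)), hsymm]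
    have h1 : HasFDerivAt (fun y : 𝔼 => (y, t)) (ContinuousLinearMap.inl ℝ 𝔼 ℝ) x :=
      hasFDerivAt_prodMk_left x t
    have h2 : HasFDerivAt (fun y : 𝔼 => fderiv ℝ F (y, t)) _ x := HasFDerivAt.comp x hF2 h1
    have h3 := h2.clm_apply (hasFDerivAt_const ((0 : 𝔼), (1 : ℝ)) x)
    have h4 : (fun y : 𝔼 => fderiv ℝ F (y, t) (0, 1)) = fun y => -sumBiLap (fun y => f y t) y :=
      funext fun y => (htime y t ht).symm
    rw [h4] at h3
    have h5 := congrArg (fun A : 𝔼 →L[ℝ] ℝ => A (EuclideanSpace.single j 1)) h3.fun_neg.fderiv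
    simp only [neg_neg] at h5
    change _root_.partialDeriv j (sumBiLap fun y => f y t) x = _ at h5
    rw [h5]
    simp
  rw [hval]
  have h1 : HasDerivAt (fun τ : ℝ => (x, τ)) ((0 : 𝔼), (1 : ℝ)) t :=
    (hasDerivAt_const t x).prodMk (hasDerivAt_id t)
  have h2 := (hF2.comp_hasDerivAt t h1).clm_apply
    (hasDerivAt_const t ((EuclideanSpace.single j 1, 0) : 𝔼 × ℝ))
  simp only [map_zero, add_zero] at h2
  refine h2.congr_of_eventuallyEq ?_
  filter_upwards [isOpen_Ioo.mem_nhds ht] with τ hτ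
  exact hspace x τ hτ

theorem SolvesBiharmonic.iterPartial {T : ℝ} (hT : 0 < T) {f : 𝔼 → ℝ → ℝ}
    (hf : SolvesBiharmonic T f) (L : List (Fin n)) :
    SolvesBiharmonic T fun x t => iterPartial L (fun y => f y t) x := by
  induction L generalizing f with
  | nil => exact hf
  | cons j L ih => exact ih (hf.partialDeriv hT j)

theorem SolvesBiharmonic.continuousOn {T : ℝ} {f : 𝔼 → ℝ → ℝ} (hf : SolvesBiharmonic T f) :
    ContinuousOn (fun p : 𝔼 × ℝ => f p.1 p.2) (univ ×ˢ Icc 0 T) :=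
  hf.smooth.continuousOn

theorem SolvesBiharmonic.continuousOn_sumBiLap {T : ℝ} (hT : 0 < T) {f : 𝔼 → ℝ → ℝ}
    (hf : SolvesBiharmonic T f) :
    ContinuousOn (fun p : 𝔼 × ℝ => sumBiLap (fun y => f y p.2) p.1) (univ ×ˢ Icc 0 T) :=
  continuousOn_finsetSum _ fun i _ => continuousOn_finsetSum _ fun j _ =>
    (hf.iterPartial hT [j, j, i, i]).continuousOn

/-- Parabolic rescaling of a solution about `a`, from time `r⁴ T` to time `T`. -/
theorem SolvesBiharmonic.rescale {T T' r : ℝ} (hr : 0 < r) {f : 𝔼 → ℝ → ℝ}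
    (hf : SolvesBiharmonic T' f) (hT : r ^ 4 * T ≤ T') (a : 𝔼) :
    SolvesBiharmonic T fun z τ => f (a + r • z) (r ^ 4 * τ) := by
  have hmem : ∀ τ ∈ Icc 0 T, r ^ 4 * τ ∈ Icc 0 T' := fun τ hτ =>
    ⟨mul_nonneg (by positivity) hτ.1, le_trans (by gcongr; exact hτ.2) hT⟩
  refine ⟨?_, fun x t ht => ?_⟩
  · have hg : ContDiff ℝ ∞ fun p : 𝔼 × ℝ => (a + r • p.1, r ^ 4 * p.2) :=
      (contDiff_const.add (contDiff_fst.const_smul r)).prodMk (contDiff_const.mul contDiff_snd)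
    exact hf.smooth.comp hg.contDiffOn fun p hp => ⟨mem_univ _, hmem _ hp.2⟩
  · have ht' : r ^ 4 * t ∈ Ioo 0 T' :=
      ⟨mul_pos (by positivity) ht.1, lt_of_lt_of_le (by gcongr; exact ht.2) hT⟩
    have h1 : HasDerivAt (fun τ : ℝ => r ^ 4 * τ) (r ^ 4) t := by
      simpa using (hasDerivAt_id t).const_mul (r ^ 4)
    have h2 := (hf.equation (a + r • x) _ ht').comp t h1
    rw [sumBiLap_comp_affine (contDiff_slice hf.smooth (Ioo_subset_Icc_self ht')) a r]
    exact h2.congr_deriv (by ring)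

theorem IsSmoothBiharmonicFlow.solvesBiharmonic {T : ℝ} {u : 𝔼 → ℝ → ℝ}
    (hu : IsSmoothBiharmonicFlow T u) : SolvesBiharmonic T u := by
  refine ⟨hu.smooth, fun x t ht => ?_⟩
  rw [← biLaplacian_eq_sumBiLap (contDiff_slice hu.smooth (Ioo_subset_Icc_self ht))]
  exact (hu.equation x t (Ioo_subset_Icc_self ht)).hasDerivAt (Icc_mem_nhds ht.1 ht.2)

end Solutions

/-! ### Dilated kernels and their commutators with a cutoff -/

section Commutator

open Set
open scoped SchwartzMap

variable {n : ℕ}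

local notation "𝔼" => EuclideanSpace ℝ (Fin n)

theorem exists_schwartz_iterPartial (K : 𝓢(𝔼, ℝ)) (L : List (Fin n)) :
    ∃ K' : 𝓢(𝔼, ℝ), iterPartial L K = K' := by
  induction L generalizing K with
  | nil => exact ⟨K, rfl⟩
  | cons j L ih =>
    exact ih (LineDeriv.lineDerivOp (EuclideanSpace.single j (1 : ℝ) : 𝔼) K)

/-- The dilate `cⁿ K (c y)`, of the same integral as `K`. With `c = t ^ (-1 / 4)` this is the
kernel at time `t` whose profile at time one is `K`. -/
noncomputable def dilate (K : 𝔼 → ℝ) (c : ℝ) : 𝔼 → ℝ := fun y => c ^ n * K (c • y)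

theorem contDiff_dilate {K : 𝔼 → ℝ} (hK : ContDiff ℝ ∞ K) (c : ℝ) : ContDiff ℝ ∞ (dilate K c) :=
  contDiff_const.mul (hK.comp (contDiff_id.const_smul c))

theorem iterPartial_dilate {K : 𝔼 → ℝ} (hK : ContDiff ℝ ∞ K) (c : ℝ) (L : List (Fin n)) (y : 𝔼) :
    iterPartial L (dilate K c) y = c ^ (n + L.length) * iterPartial L K (c • y) := by
  have h1 := iterPartial_comp_affine hK 0 c L
  simp only [zero_add] at h1
  have h2 := iterPartial_const_smul (c ^ n) (fun y => K (c • y)) L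
  rw [h1] at h2
  have h3 := congrFun h2 y
  simp only [Pi.smul_apply, smul_eq_mul] at h3
  rw [pow_add, mul_assoc, ← h3]
  rfl

theorem sumBiLap_dilate {K : 𝔼 → ℝ} (hK : ContDiff ℝ ∞ K) (c : ℝ) (y : 𝔼) :
    sumBiLap (dilate K c) y = c ^ (n + 4) * sumBiLap K (c • y) := by
  simp [sumBiLap, iterPartial_dilate hK, Finset.mul_sum]

/-- Away from the origin the derivatives of all dilates of a Schwartz function are bounded
uniformly in the dilation: the decay of `K` compensates the growing powers of `c`. -/
theorem exists_bound_iterPartial_dilate (K : 𝓢(𝔼, ℝ)) (L : List (Fin n)) :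
    ∃ C : ℝ, 0 ≤ C ∧ ∀ c : ℝ, 0 < c → ∀ y : 𝔼, 1 / 2 ≤ ‖y‖ →
      |iterPartial L (dilate K c) y| ≤ C := by
  obtain ⟨K', hK'⟩ := exists_schwartz_iterPartial K L
  set m := n + L.length
  obtain ⟨C, hC, h⟩ := K'.decay m 0
  refine ⟨2 ^ m * C, by positivity, fun c hc y hy => ?_⟩
  rw [iterPartial_dilate (K.smooth ⊤), hK', abs_mul, abs_of_pos (by positivity)]
  have h1 := h (c • y)
  rw [norm_iteratedFDeriv_zero, Real.norm_eq_abs, norm_smul, Real.norm_of_nonneg hc.le,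
    mul_pow] at h1
  have h2 : (1 / 2 : ℝ) ^ m ≤ ‖y‖ ^ m := by gcongr
  calc c ^ m * |K' (c • y)| = 2 ^ m * (c ^ m * (1 / 2) ^ m * |K' (c • y)|) := by
        rw [one_div, inv_pow]; field_simp
    _ ≤ 2 ^ m * (c ^ m * ‖y‖ ^ m * |K' (c • y)|) := by gcongr
    _ ≤ 2 ^ m * C := by gcongr

/-- A bound for each list of coordinates gives one for all lists of bounded length. -/
theorem exists_bound_of_length_le {P : List (Fin n) → ℝ → Prop}
    (hmono : ∀ L a b, a ≤ b → P L a → P L b) (h : ∀ L, ∃ C : ℝ, 0 ≤ C ∧ P L C) (m : ℕ) :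
    ∃ C : ℝ, 0 ≤ C ∧ ∀ L : List (Fin n), L.length ≤ m → P L C := by
  choose C hC hP using h
  have hfin : {L : List (Fin n) | L.length ≤ m}.Finite := List.finite_length_le (Fin n) m
  refine ⟨∑ L ∈ hfin.toFinset, C L, Finset.sum_nonneg fun L _ => hC L, fun L hL => ?_⟩
  exact hmono L _ _ (Finset.single_le_sum (f := C) (fun M _ => hC M)
    (hfin.mem_toFinset.2 hL)) (hP L)

theorem exists_bound_iterPartial_of_hasCompactSupport {φ : 𝔼 → ℝ} (hφ : ContDiff ℝ ∞ φ)
    (hs : HasCompactSupport φ) (L : List (Fin n)) :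
    ∃ C : ℝ, 0 ≤ C ∧ ∀ y, |iterPartial L φ y| ≤ C := by
  have hs' : HasCompactSupport (iterPartial L φ) :=
    hs.of_isClosed_subset (isClosed_tsupport _) (tsupport_iterPartial_subset φ L)
  obtain ⟨C, hC⟩ := hs'.exists_bound_of_continuous (contDiff_iterPartial hφ L).continuous
  exact ⟨C, (norm_nonneg _).trans (hC 0), hC⟩

/-- The commutator `φ Δ² κ - Δ² (φ κ)`. -/
noncomputable def biLapCommutator (φ κ : 𝔼 → ℝ) : 𝔼 → ℝ :=
  φ * sumBiLap κ + (-1 : ℝ) • sumBiLap (φ * κ)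

theorem contDiff_biLapCommutator {φ κ : 𝔼 → ℝ} (hφ : ContDiff ℝ ∞ φ) (hκ : ContDiff ℝ ∞ κ) :
    ContDiff ℝ ∞ (biLapCommutator φ κ) :=
  (hφ.mul (contDiff_sumBiLap hκ)).add (contDiff_const.smul (contDiff_sumBiLap (hφ.mul hκ)))

theorem tsupport_biLapCommutator_subset (φ κ : 𝔼 → ℝ) :
    tsupport (biLapCommutator φ κ) ⊆ tsupport φ := by
  intro x hx
  by_contra hx'
  rw [notMem_tsupport_iff_eventuallyEq] at hx'
  refine (notMem_tsupport_iff_eventuallyEq.2 ?_) hx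
  have h1 : φ * κ =ᶠ[nhds x] 0 := by
    filter_upwards [hx'] with y hy
    simp [hy]
  have h2 := sumBiLap_eventuallyEq h1
  filter_upwards [hx', h2] with y hy hy2
  simp only [biLapCommutator, Pi.add_apply, Pi.mul_apply, Pi.smul_apply, hy, hy2]
  simp [sumBiLap, iterPartial_zero]

/-- Where the cutoff is locally one there is no commutator, and away from the origin the kernels
are uniformly smooth; so the commutator is smooth uniformly in the dilation. -/
theorem exists_bound_iterPartial_biLapCommutator (K : 𝓢(𝔼, ℝ)) {φ : 𝔼 → ℝ}
    (hφ : ContDiff ℝ ∞ φ) (hs : HasCompactSupport φ)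
    (hone : ∀ y ∈ Metric.ball (0 : 𝔼) (1 / 2), φ y = 1)
    (L : List (Fin n)) :
    ∃ C : ℝ, 0 ≤ C ∧ ∀ c : ℝ, 0 < c → ∀ y : 𝔼,
      |iterPartial L (biLapCommutator φ (dilate K c)) y| ≤ C := by
  obtain ⟨A, hA, hφA⟩ := exists_bound_of_length_le
    (P := fun L C => ∀ y, |iterPartial L φ y| ≤ C) (fun L a b hab h y => (h y).trans hab)
    (exists_bound_iterPartial_of_hasCompactSupport hφ hs) (L.length + 4)
  obtain ⟨B, hB, hKB⟩ := exists_bound_of_length_le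
    (P := fun L C => ∀ c : ℝ, 0 < c → ∀ y : 𝔼, 1 / 2 ≤ ‖y‖ → |iterPartial L (dilate K c) y| ≤ C)
    (fun L a b hab h c hc y hy => (h c hc y hy).trans hab)
    (exists_bound_iterPartial_dilate K) (L.length + 4)
  refine ⟨2 ^ L.length * (A * (n * (n * B))) +
    n * (n * (2 ^ (L.length + 4) * (A * B))), by positivity, fun c hc y => ?_⟩
  have hκ : ContDiff ℝ ∞ (dilate K c) := contDiff_dilate (K.smooth ⊤) c
  rcases lt_or_ge ‖y‖ (1 / 2) with hy | hy
  · have hev : φ =ᶠ[nhds y] 1 := by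
      filter_upwards [Metric.isOpen_ball.mem_nhds (mem_ball_zero_iff.2 hy)] with z hz
      exact hone z hz
    have h1 : φ * dilate K c =ᶠ[nhds y] dilate K c := by
      filter_upwards [hev] with z hz
      simp [hz]
    have h2 : biLapCommutator φ (dilate K c) =ᶠ[nhds y] 0 := by
      filter_upwards [hev, sumBiLap_eventuallyEq h1] with z hz hz2
      simp [biLapCommutator, hz, hz2]
    rw [(iterPartial_eventuallyEq h2 L).eq_of_nhds, iterPartial_zero]
    simp only [Pi.zero_apply, abs_zero]
    positivity
  · have hsum : ∀ (g : 𝔼 → ℝ) (M : List (Fin n)) (D : ℝ), ContDiff ℝ ∞ g →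
        (∀ i j, |iterPartial ([j, j, i, i] ++ M) g y| ≤ D) →
        |iterPartial M (sumBiLap g) y| ≤ n * (n * D) := by
      intro g M D hg hD
      rw [iterPartial_sumBiLap hg]
      simp only [Finset.sum_apply]
      calc |∑ i, ∑ j, iterPartial ([j, j, i, i] ++ M) g y|
          ≤ ∑ i, ∑ j, |iterPartial ([j, j, i, i] ++ M) g y| :=
            (Finset.abs_sum_le_sum_abs _ _).trans
              (Finset.sum_le_sum fun i _ => Finset.abs_sum_le_sum_abs _ _)
        _ ≤ ∑ _i : Fin n, ∑ _j : Fin n, D :=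
            Finset.sum_le_sum fun i _ => Finset.sum_le_sum fun j _ => hD i j
        _ = n * (n * D) := by simp
    have hm1 : ContDiff ℝ ∞ (φ * sumBiLap (dilate K c)) := hφ.mul (contDiff_sumBiLap hκ)
    have hm2 : ContDiff ℝ ∞ (φ * dilate K c) := hφ.mul hκ
    have hm3 : ContDiff ℝ ∞ ((-1 : ℝ) • sumBiLap (φ * dilate K c)) :=
      contDiff_const.smul (contDiff_sumBiLap hm2)
    rw [biLapCommutator, iterPartial_add hm1 hm3, iterPartial_const_smul]
    have h1 : |iterPartial L (φ * sumBiLap (dilate K c)) y| ≤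
        2 ^ L.length * (A * (n * (n * B))) := by
      refine abs_iterPartial_mul_le hφ (contDiff_sumBiLap hκ) hA y L
        (fun M hM => hφA M (by omega) y) (fun M hM => hsum _ M B hκ fun i j => ?_)
      exact hKB _ (by simp; omega) c hc y hy
    have h2 : |iterPartial L (sumBiLap (φ * dilate K c)) y| ≤
        n * (n * (2 ^ (L.length + 4) * (A * B))) := by
      refine hsum _ L _ hm2 fun i j => ?_
      have hl : ([j, j, i, i] ++ L).length = L.length + 4 := by simp
      have h3 := abs_iterPartial_mul_le hφ hκ hA y ([j, j, i, i] ++ L)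
        (fun M hM => hφA M (by omega) y) (fun M hM => hKB M (by omega) c hc y hy)
      rwa [hl] at h3
    calc _ ≤ |iterPartial L (φ * sumBiLap (dilate K c)) y| +
          |(-1 : ℝ) * iterPartial L (sumBiLap (φ * dilate K c)) y| := abs_add_le _ _
      _ ≤ _ := by
          rw [neg_one_mul, abs_neg]
          exact add_le_add h1 h2

end Commutator

/-! ### Parametric integrals, cutoffs and the backward kernel -/

section Duhamel

open Set MeasureTheory Filter Topology
open scoped SchwartzMap

variable {n : ℕ}

local notation "𝔼" => EuclideanSpace ℝ (Fin n)

/-- Differentiation under the integral sign for integrands supported in a fixed compact set. -/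
theorem hasDerivAt_integral_of_compact {f f' : 𝔼 → ℝ → ℝ} {I : Set ℝ} (hI : IsOpen I)
    {k : Set 𝔼} (hk : IsCompact k)
    (hf : ContinuousOn (fun p : 𝔼 × ℝ => f p.1 p.2) (univ ×ˢ I))
    (hf' : ContinuousOn (fun p : 𝔼 × ℝ => f' p.1 p.2) (univ ×ˢ I))
    (hz : ∀ τ ∈ I, ∀ y ∉ k, f y τ = 0) (hz' : ∀ τ ∈ I, ∀ y ∉ k, f' y τ = 0)
    (hd : ∀ τ ∈ I, ∀ y, HasDerivAt (fun s => f y s) (f' y τ) τ) {t : ℝ} (ht : t ∈ I) :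
    HasDerivAt (fun τ => ∫ y, f y τ) (∫ y, f' y t) t := by
  obtain ⟨ε, hε, hεI⟩ := Metric.nhds_basis_closedBall.mem_iff.1 (hI.mem_nhds ht)
  have hslice : ∀ {g : 𝔼 → ℝ → ℝ}, ContinuousOn (fun p : 𝔼 × ℝ => g p.1 p.2) (univ ×ˢ I) →
      ∀ τ ∈ I, Continuous fun y => g y τ := by
    intro g hg τ hτ
    rw [← continuousOn_univ]
    exact hg.comp (by fun_prop : Continuous fun y : 𝔼 => (y, τ)).continuousOn
      fun y _ => ⟨mem_univ _, hτ⟩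
  obtain ⟨M, hM⟩ := (hk.prod (isCompact_closedBall t ε)).exists_bound_of_continuousOn
    (hf'.mono (prod_mono (subset_univ _) hεI))
  refine (hasDerivAt_integral_of_dominated_loc_of_deriv_le (μ := volume)
    (F := fun τ y => f y τ) (F' := fun τ y => f' y τ) (bound := k.indicator fun _ => M)
    (Metric.closedBall_mem_nhds t hε) ?_ ?_ ?_ ?_ ?_ ?_).2
  · filter_upwards [hI.mem_nhds ht] with τ hτ
    exact (hslice hf τ hτ).aestronglyMeasurable
  · exact (hslice hf t ht).integrable_of_hasCompactSupport
      (HasCompactSupport.intro hk fun y hy => hz t ht y hy)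
  · exact (hslice hf' t ht).aestronglyMeasurable
  · refine Eventually.of_forall fun y τ hτ => ?_
    by_cases hy : y ∈ k
    · rw [indicator_of_mem hy]
      exact hM (y, τ) ⟨hy, hτ⟩
    · rw [indicator_of_notMem hy, hz' τ (hεI hτ) y hy, norm_zero]
  · exact (integrable_indicator_iff hk.measurableSet).2
      (integrableOn_const hk.measure_lt_top.ne)
  · exact Eventually.of_forall fun y τ hτ => hd τ (hεI hτ) y

/-- A function whose derivative is `O(τ ^ (-1/4))` is controlled down to time zero. -/
theorem abs_sub_le_of_abs_deriv_le {F F' : ℝ → ℝ} {b M : ℝ} (hb : 0 ≤ b)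
    (hc : ContinuousOn F (Icc 0 b)) (hd : ∀ τ ∈ Ioo 0 b, HasDerivAt F (F' τ) τ)
    (hM : ∀ τ ∈ Ioo 0 b, |F' τ| ≤ M * τ ^ (-(1 / 4) : ℝ)) :
    |F b - F 0| ≤ 4 / 3 * M * b ^ (3 / 4 : ℝ) := by
  have key : ∀ G G' : ℝ → ℝ, ContinuousOn G (Icc 0 b) →
      (∀ τ ∈ Ioo 0 b, HasDerivAt G (G' τ) τ) →
      (∀ τ ∈ Ioo 0 b, G' τ ≤ M * τ ^ (-(1 / 4) : ℝ)) →
      G b - G 0 ≤ 4 / 3 * M * b ^ (3 / 4 : ℝ) := by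
    intro G G' hGc hGd hGM
    have hd' : ∀ τ ∈ Ioo 0 b, HasDerivAt (fun τ => G τ - 4 / 3 * M * τ ^ (3 / 4 : ℝ))
        (G' τ - M * τ ^ (-(1 / 4) : ℝ)) τ := by
      intro τ hτ
      have h1 := (Real.hasDerivAt_rpow_const (p := 3 / 4) (Or.inl hτ.1.ne')).const_mul (4 / 3 * M)
      refine ((hGd τ hτ).sub h1).congr_deriv ?_
      rw [show (3 / 4 : ℝ) - 1 = -(1 / 4) by norm_num]
      ring
    have hanti : AntitoneOn (fun τ => G τ - 4 / 3 * M * τ ^ (3 / 4 : ℝ)) (Icc 0 b) := by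
      refine antitoneOn_of_deriv_nonpos (convex_Icc 0 b) ?_ ?_ ?_
      · exact hGc.sub ((Real.continuous_rpow_const (by norm_num)).const_mul _).continuousOn
      · rw [interior_Icc]
        exact fun τ hτ => (hd' τ hτ).differentiableAt.differentiableWithinAt
      · rw [interior_Icc]
        intro τ hτ
        rw [(hd' τ hτ).deriv]
        linarith [hGM τ hτ]
    have := hanti (left_mem_Icc.2 hb) (right_mem_Icc.2 hb) hb
    simp only [Real.zero_rpow (by norm_num : (3 / 4 : ℝ) ≠ 0)] at this
    linarith
  rw [abs_le]
  constructor
  · have := key (fun τ => -F τ) (fun τ => -F' τ) hc.neg (fun τ hτ => (hd τ hτ).neg)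
      (fun τ hτ => (neg_le_abs _).trans (hM τ hτ))
    linarith
  · exact key F F' hc hd fun τ hτ => (le_abs_self _).trans (hM τ hτ)

/-- A smooth cutoff supported in the ball of radius `3 / 4` that is one on the ball of radius
`1 / 2`. -/
structure IsCutoff (φ : 𝔼 → ℝ) : Prop where
  smooth : ContDiff ℝ ∞ φ
  tsupport_subset : tsupport φ ⊆ Metric.closedBall 0 (3 / 4)
  nonneg : ∀ y, 0 ≤ φ y
  le_one : ∀ y, φ y ≤ 1
  eq_one : ∀ y ∈ Metric.ball (0 : 𝔼) (1 / 2), φ y = 1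

theorem exists_isCutoff (n : ℕ) : ∃ φ : EuclideanSpace ℝ (Fin n) → ℝ, IsCutoff φ := by
  let f : ContDiffBump (0 : EuclideanSpace ℝ (Fin n)) := ⟨1 / 2, 3 / 4, by norm_num, by norm_num⟩
  exact ⟨f, f.contDiff, f.tsupport_eq.le, fun y => f.nonneg, fun y => f.le_one,
    fun y hy => f.one_of_mem_closedBall (Metric.ball_subset_closedBall hy)⟩

theorem IsCutoff.hasCompactSupport {φ : 𝔼 → ℝ} (hφ : IsCutoff φ) : HasCompactSupport φ :=
  (isCompact_closedBall _ _).of_isClosed_subset (isClosed_tsupport _) hφ.tsupport_subset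

theorem IsCutoff.eq_zero {φ : 𝔼 → ℝ} (hφ : IsCutoff φ) {y : 𝔼}
    (hy : y ∉ Metric.closedBall (0 : 𝔼) (3 / 4)) : φ y = 0 :=
  image_eq_zero_of_notMem_tsupport fun h => hy (hφ.tsupport_subset h)

/-- The dilation factor of the backward kernel with pole at time `T`. -/
noncomputable def dilationFactor (T τ : ℝ) : ℝ := (T - τ) ^ (-(1 / 4) : ℝ)

theorem dilationFactor_pos {T τ : ℝ} (h : τ < T) : 0 < dilationFactor T τ :=
  Real.rpow_pos_of_pos (by linarith) _

theorem continuousOn_dilationFactor (T : ℝ) : ContinuousOn (dilationFactor T) (Iio T) := by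
  refine ContinuousOn.rpow_const (by fun_prop) fun τ hτ => Or.inl ?_
  have : τ < T := hτ
  linarith

/-- The kernel solves the backward biharmonic heat equation. -/
theorem hasDerivAt_dilate {K : 𝔼 → ℝ} (hK : ContDiff ℝ ∞ K)
    (heq : ∀ z, 4 * sumBiLap K z = n * K z + fderiv ℝ K z z) {T τ : ℝ} (h : τ < T) (y : 𝔼) :
    HasDerivAt (fun τ => dilate K (dilationFactor T τ) y)
      (sumBiLap (dilate K (dilationFactor T τ)) y) τ := by
  set c := dilationFactor T τ with hc
  have hcpos : 0 < c := dilationFactor_pos h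
  have h1 : HasDerivAt (dilationFactor T) (c ^ 5 / 4) τ := by
    have h2 := ((hasDerivAt_id τ).const_sub T).rpow_const (p := -(1 / 4))
      (Or.inl (by simp only [id]; linarith))
    refine h2.congr_deriv ?_
    have h3 : c ^ 5 = (T - τ) ^ (-(1 / 4) - 1 : ℝ) := by
      rw [hc, dilationFactor, ← Real.rpow_natCast, ← Real.rpow_mul (by linarith)]
      norm_num
    rw [h3]
    simp only [id]
    ring
  have h4 : HasDerivAt (fun c : ℝ => c • y) y c := by
    simpa using (hasDerivAt_id c).smul_const y
  have h5 := (hK.differentiable (by simp) (c • y)).hasFDerivAt.comp_hasDerivAt c h4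
  have h6 := ((hasDerivAt_pow n c).mul h5).comp τ h1
  refine h6.congr_deriv ?_
  rw [sumBiLap_dilate hK]
  have h7 := heq (c • y)
  rw [map_smul, smul_eq_mul] at h7
  have h8 : (n : ℝ) * c ^ (n - 1) * c = n * c ^ n := by
    cases n with
    | zero => simp
    | succ m => rw [Nat.add_sub_cancel, pow_succ]; ring
  have h9 : sumBiLap K (c • y) = (n * K (c • y) + c * fderiv ℝ K (c • y) y) / 4 := by linarith
  rw [h9]
  simp only [Function.comp_apply]
  linear_combination (c ^ 4 / 4 * K (c • y)) * h8

end Duhamel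

/-! ### The interior estimate at unit scale -/

section InteriorEstimate

open Set MeasureTheory Filter Topology
open scoped SchwartzMap

variable {n : ℕ}

local notation "𝔼" => EuclideanSpace ℝ (Fin n)

/-- A solution tested against the cut-off backward kernel with pole at the origin at time `T`. -/
noncomputable def testedSolution (K φ : 𝔼 → ℝ) (T : ℝ) (v : 𝔼 → ℝ → ℝ) (τ : ℝ) : ℝ :=
  ∫ y, v y τ * (φ y * dilate K (dilationFactor T τ) y)

theorem continuousOn_dilate_dilationFactor {K : 𝔼 → ℝ} (hK : Continuous K) (T : ℝ) :
    ContinuousOn (fun p : 𝔼 × ℝ => dilate K (dilationFactor T p.2) p.1) (univ ×ˢ Iio T) := by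
  have h1 : ContinuousOn (fun p : 𝔼 × ℝ => dilationFactor T p.2) (univ ×ˢ Iio T) :=
    (continuousOn_dilationFactor T).comp continuous_snd.continuousOn fun p hp => hp.2
  exact (h1.pow n).mul (hK.comp_continuousOn (h1.smul continuous_fst.continuousOn))

theorem continuousOn_testedSolution {K φ : 𝔼 → ℝ} (hK : Continuous K) (hφ : IsCutoff φ) {T : ℝ}
    {v : 𝔼 → ℝ → ℝ} (hv : SolvesBiharmonic T v) :
    ContinuousOn (testedSolution K φ T v) (Ico 0 T) := by
  refine continuousOn_integral_of_compact_support (k := Metric.closedBall (0 : 𝔼) (3 / 4))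
    (isCompact_closedBall _ _) ?_ ?_
  · have h1 : ContinuousOn (fun p : 𝔼 × ℝ =>
        v p.1 p.2 * (φ p.1 * dilate K (dilationFactor T p.2) p.1)) (univ ×ˢ Ico 0 T) :=
      (hv.continuousOn.mono (prod_mono subset_rfl Ico_subset_Icc_self)).mul
        ((hφ.smooth.continuous.comp continuous_fst).continuousOn.mul
          ((continuousOn_dilate_dilationFactor hK T).mono
            (prod_mono subset_rfl fun τ hτ => hτ.2)))
    exact h1.comp continuous_swap.continuousOn fun p hp => ⟨mem_univ _, hp.1⟩
  · intro τ y _ hy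
    simp [hφ.eq_zero hy]

/-- Duhamel's principle: only the commutator with the cutoff contributes. -/
theorem hasDerivAt_testedSolution {K φ : 𝔼 → ℝ} (hK : ContDiff ℝ ∞ K)
    (heq : ∀ z, 4 * sumBiLap K z = n * K z + fderiv ℝ K z z) (hφ : IsCutoff φ) {T : ℝ}
    {v : 𝔼 → ℝ → ℝ} (hv : SolvesBiharmonic T v) {t : ℝ} (ht : t ∈ Ioo 0 T) :
    HasDerivAt (testedSolution K φ T v)
      (∫ y, v y t * biLapCommutator φ (dilate K (dilationFactor T t)) y) t := by
  have hT : 0 < T := ht.1.trans ht.2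
  have hcv : ContinuousOn (fun p : 𝔼 × ℝ => v p.1 p.2) (univ ×ˢ Ioo 0 T) :=
    hv.continuousOn.mono (prod_mono subset_rfl Ioo_subset_Icc_self)
  have hcB : ContinuousOn (fun p : 𝔼 × ℝ => sumBiLap (fun y => v y p.2) p.1) (univ ×ˢ Ioo 0 T) :=
    (hv.continuousOn_sumBiLap hT).mono (prod_mono subset_rfl Ioo_subset_Icc_self)
  have hcφ : ContinuousOn (fun p : 𝔼 × ℝ => φ p.1) (univ ×ˢ Ioo 0 T) :=
    (hφ.smooth.continuous.comp continuous_fst).continuousOn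
  have hsub : (univ : Set 𝔼) ×ˢ Ioo 0 T ⊆ univ ×ˢ Iio T := prod_mono subset_rfl fun τ hτ => hτ.2
  have hcK : ContinuousOn (fun p : 𝔼 × ℝ => dilate K (dilationFactor T p.2) p.1)
      (univ ×ˢ Ioo 0 T) := (continuousOn_dilate_dilationFactor hK.continuous T).mono hsub
  have hcKB : ContinuousOn (fun p : 𝔼 × ℝ => sumBiLap (dilate K (dilationFactor T p.2)) p.1)
      (univ ×ˢ Ioo 0 T) := by
    simp only [sumBiLap_dilate hK]
    have h1 : ContinuousOn (fun p : 𝔼 × ℝ => dilationFactor T p.2) (univ ×ˢ Ioo 0 T) :=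
      (continuousOn_dilationFactor T).comp continuous_snd.continuousOn fun p hp => hp.2.2
    exact (h1.pow _).mul ((contDiff_sumBiLap hK).continuous.comp_continuousOn
      (h1.smul continuous_fst.continuousOn))
  have hder := hasDerivAt_integral_of_compact (n := n) (I := Ioo 0 T)
    (f := fun y τ => v y τ * (φ y * dilate K (dilationFactor T τ) y))
    (f' := fun y τ => -sumBiLap (fun y => v y τ) y * (φ y * dilate K (dilationFactor T τ) y) +
      v y τ * (φ y * sumBiLap (dilate K (dilationFactor T τ)) y))
    isOpen_Ioo (isCompact_closedBall (0 : 𝔼) (3 / 4)) (hcv.mul (hcφ.mul hcK))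
    ((hcB.neg.mul (hcφ.mul hcK)).add (hcv.mul (hcφ.mul hcKB)))
    (fun τ _ y hy => by simp [hφ.eq_zero hy]) (fun τ _ y hy => by simp [hφ.eq_zero hy])
    (fun τ hτ y => (hv.equation y τ hτ).mul ((hasDerivAt_dilate hK heq hτ.2 y).const_mul (φ y))) ht
  refine hder.congr_deriv ?_
  set κ := dilate K (dilationFactor T t) with hκdef
  have hκ : ContDiff ℝ ∞ κ := contDiff_dilate hK _
  have hvt : ContDiff ℝ ∞ fun y => v y t := contDiff_slice hv.smooth (Ioo_subset_Icc_self ht)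
  have hφκ : ContDiff ℝ ∞ (φ * κ) := hφ.smooth.mul hκ
  have hφκs : HasCompactSupport (φ * κ) := hφ.hasCompactSupport.mul_right
  have hint : ∀ g h : 𝔼 → ℝ, Continuous g → Continuous h → HasCompactSupport h →
      Integrable fun y => g y * h y := fun g h hg hh hs =>
    (hg.mul hh).integrable_of_hasCompactSupport hs.mul_left
  have hBs : HasCompactSupport (sumBiLap (φ * κ)) := by
    refine HasCompactSupport.intro hφκs fun y hy => ?_
    have := sumBiLap_eventuallyEq (notMem_tsupport_iff_eventuallyEq.1 hy)
    rw [this.eq_of_nhds]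
    simp [sumBiLap, iterPartial_zero]
  have hi1 := hint _ _ hvt.continuous (contDiff_sumBiLap hφκ).continuous hBs
  have hi2 := hint (fun y => v y t) (φ * sumBiLap κ) hvt.continuous
    (hφ.smooth.continuous.mul (contDiff_sumBiLap hκ).continuous) hφ.hasCompactSupport.mul_right
  have hi3 := hint (fun y => -sumBiLap (fun y => v y t) y) (φ * κ)
    (contDiff_sumBiLap hvt).continuous.neg hφκ.continuous hφκs
  have hparts := integral_mul_sumBiLap hvt hφκ hφκs
  calc ∫ y, (-sumBiLap (fun y => v y t) y * (φ y * κ y) + v y t * (φ y * sumBiLap κ y))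
      = (∫ y, -sumBiLap (fun y => v y t) y * (φ * κ) y) + ∫ y, v y t * (φ * sumBiLap κ) y :=
        integral_add hi3 hi2
    _ = (∫ y, v y t * (φ * sumBiLap κ) y) - ∫ y, v y t * sumBiLap (φ * κ) y := by
        rw [hparts]
        simp only [neg_mul]
        rw [integral_neg]
        ring
    _ = ∫ y, (v y t * (φ * sumBiLap κ) y - v y t * sumBiLap (φ * κ) y) :=
        (integral_sub hi2 hi1).symm
    _ = ∫ y, v y t * biLapCommutator φ κ y := by
        congr 1
        funext y
        simp only [biLapCommutator, Pi.add_apply, Pi.smul_apply, smul_eq_mul]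
        ring

theorem testedSolution_eq_integral {K φ : 𝔼 → ℝ} {T : ℝ} {v : 𝔼 → ℝ → ℝ} {τ : ℝ} (hτ : τ < T) :
    testedSolution K φ T v τ = ∫ z, v ((T - τ) ^ (1 / 4 : ℝ) • z) τ *
      φ ((T - τ) ^ (1 / 4 : ℝ) • z) * K z := by
  set c := dilationFactor T τ with hc
  have hcpos : 0 < c := dilationFactor_pos hτ
  have hρ : (T - τ) ^ (1 / 4 : ℝ) = c⁻¹ := by
    rw [hc, dilationFactor, Real.rpow_neg (by linarith), inv_inv]
  rw [hρ]
  have h := Measure.integral_comp_smul (volume : Measure 𝔼)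
    (fun z => v (c⁻¹ • z) τ * φ (c⁻¹ • z) * K z) c
  rw [finrank_euclideanSpace_fin, abs_of_pos (by positivity)] at h
  have h2 : ∫ z, v (c⁻¹ • z) τ * φ (c⁻¹ • z) * K z = c ^ n *
      ∫ y, v (c⁻¹ • c • y) τ * φ (c⁻¹ • c • y) * K (c • y) := by
    rw [h, smul_eq_mul, ← mul_assoc, mul_inv_cancel₀ (by positivity), one_mul]
  rw [h2, ← integral_const_mul, testedSolution]
  congr 1
  funext y
  rw [smul_smul, inv_mul_cancel₀ hcpos.ne', one_smul, ← hc, dilate]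
  ring

/-- At the pole the kernel becomes a Dirac mass. -/
theorem tendsto_testedSolution (K : 𝓢(𝔼, ℝ)) (hK1 : ∫ z, K z = 1) {φ : 𝔼 → ℝ} (hφ : IsCutoff φ)
    {T : ℝ} (hT : 0 < T) {v : 𝔼 → ℝ → ℝ} (hv : SolvesBiharmonic T v) :
    Tendsto (testedSolution K φ T v) (𝓝[<] T) (𝓝 (v 0 T)) := by
  obtain ⟨M, hM⟩ := ((isCompact_closedBall (0 : 𝔼) (3 / 4)).prod
    (isCompact_Icc (a := (0 : ℝ)) (b := T))).exists_bound_of_continuousOn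
    (hv.continuousOn.mono (prod_mono (subset_univ _) subset_rfl))
  have hM0 : 0 ≤ M := (norm_nonneg _).trans (hM (0, T)
    ⟨Metric.mem_closedBall_self (by norm_num), right_mem_Icc.2 hT.le⟩)
  have hIoo : ∀ᶠ τ in 𝓝[<] T, τ ∈ Ioo 0 T := Ioo_mem_nhdsLT hT
  have hlim : Tendsto (fun τ => ∫ z, v ((T - τ) ^ (1 / 4 : ℝ) • z) τ *
      φ ((T - τ) ^ (1 / 4 : ℝ) • z) * K z) (𝓝[<] T) (𝓝 (∫ z, v 0 T * φ 0 * K z)) := by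
    refine tendsto_integral_filter_of_dominated_convergence (fun z => M * ‖K z‖) ?_ ?_
      (K.integrable.norm.const_mul M) ?_
    · filter_upwards [hIoo] with τ hτ
      have h1 : Continuous fun y => v y τ :=
        (contDiff_slice hv.smooth (Ioo_subset_Icc_self hτ)).continuous
      have h2 : Continuous φ := hφ.smooth.continuous
      have h3 : Continuous fun z : 𝔼 => (T - τ) ^ (1 / 4 : ℝ) • z := continuous_const_smul _
      exact (((h1.comp h3).mul (h2.comp h3)).mul K.continuous).aestronglyMeasurable
    · filter_upwards [hIoo] with τ hτ
      refine Eventually.of_forall fun z => ?_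
      rw [norm_mul]
      refine mul_le_mul_of_nonneg_right ?_ (norm_nonneg _)
      set w := (T - τ) ^ (1 / 4 : ℝ) • z
      by_cases hw : w ∈ Metric.closedBall (0 : 𝔼) (3 / 4)
      · rw [norm_mul, ← mul_one M]
        refine mul_le_mul (hM (w, τ) ⟨hw, Ioo_subset_Icc_self hτ⟩) ?_ (norm_nonneg _) hM0
        rw [Real.norm_of_nonneg (hφ.nonneg w)]
        exact hφ.le_one w
      · rw [hφ.eq_zero hw, mul_zero, norm_zero]
        exact hM0
    · refine Eventually.of_forall fun z => ?_
      have hρ : Tendsto (fun τ : ℝ => (T - τ) ^ (1 / 4 : ℝ)) (𝓝[<] T) (𝓝 0) := by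
        have h1 : Continuous fun τ : ℝ => (T - τ) ^ (1 / 4 : ℝ) :=
          (Real.continuous_rpow_const (by norm_num)).comp (continuous_const.sub continuous_id)
        have h2 := (h1.tendsto T).mono_left (nhdsWithin_le_nhds (s := Iio T))
        simpa [Real.zero_rpow] using h2
      have hw : Tendsto (fun τ : ℝ => (T - τ) ^ (1 / 4 : ℝ) • z) (𝓝[<] T) (𝓝 0) := by
        simpa using hρ.smul_const z
      have hid : Tendsto (fun τ : ℝ => τ) (𝓝[<] T) (𝓝 T) := tendsto_id.mono_left nhdsWithin_le_nhds
      have hpair : Tendsto (fun τ : ℝ => ((T - τ) ^ (1 / 4 : ℝ) • z, τ)) (𝓝[<] T)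
          (𝓝[univ ×ˢ Icc 0 T] ((0 : 𝔼), T)) := by
        refine tendsto_nhdsWithin_iff.2 ⟨hw.prodMk_nhds hid, ?_⟩
        filter_upwards [hIoo] with τ hτ
        exact ⟨mem_univ _, Ioo_subset_Icc_self hτ⟩
      have h1 : Tendsto (fun τ : ℝ => v ((T - τ) ^ (1 / 4 : ℝ) • z) τ) (𝓝[<] T) (𝓝 (v 0 T)) :=
        (hv.continuousOn (0, T) ⟨mem_univ _, by simp [hT.le]⟩).tendsto.comp hpair
      exact (h1.mul ((hφ.smooth.continuous.tendsto 0).comp hw)).mul_const _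
  rw [hφ.eq_one 0 (by simp), mul_one, integral_const_mul, hK1, mul_one] at hlim
  refine hlim.congr' ?_
  filter_upwards [hIoo] with τ hτ
  exact (testedSolution_eq_integral hτ.2).symm

theorem abs_testedSolution_zero_le (K : 𝓢(𝔼, ℝ)) {φ : 𝔼 → ℝ} (hφ : IsCutoff φ) {T B : ℝ}
    (hT : 0 < T) (hB : 0 ≤ B) {v : 𝔼 → ℝ → ℝ} (hv : ∀ y ∈ Metric.ball (0 : 𝔼) 1, |v y 0| ≤ B) :
    |testedSolution K φ T v 0| ≤ B * ∫ z, ‖K z‖ := by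
  rw [testedSolution_eq_integral hT, ← integral_const_mul, ← Real.norm_eq_abs]
  refine norm_integral_le_of_norm_le (K.integrable.norm.const_mul B)
    (Eventually.of_forall fun z => ?_)
  rw [norm_mul]
  refine mul_le_mul_of_nonneg_right ?_ (norm_nonneg _)
  set w := (T - 0) ^ (1 / 4 : ℝ) • z
  by_cases hw : w ∈ Metric.closedBall (0 : 𝔼) (3 / 4)
  · rw [norm_mul, ← mul_one B]
    refine mul_le_mul (hv w (Metric.closedBall_subset_ball (by norm_num) hw)) ?_
      (norm_nonneg _) hB
    rw [Real.norm_of_nonneg (hφ.nonneg w)]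
    exact hφ.le_one w
  · rw [hφ.eq_zero hw, mul_zero, norm_zero]
    exact hB

/-- Interior estimate at unit scale. One derivative stays on the solution, where it is
`O(τ ^ (-1/4))` and hence integrable in time; the others are moved to the commutator. -/
theorem exists_interior_bound (j : Fin n) (L : List (Fin n)) :
    ∃ C : ℝ, 0 ≤ C ∧ ∀ A B : ℝ, 0 ≤ A → 0 ≤ B → ∀ T : ℝ, 0 < T → T ≤ 1 →
      ∀ f : 𝔼 → ℝ → ℝ, SolvesBiharmonic T f →
      (∀ τ ∈ Ioo 0 T, ∀ y ∈ Metric.ball (0 : 𝔼) 1,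
        |partialDeriv j (fun y => f y τ) y| ≤ A * τ ^ (-(1 / 4) : ℝ)) →
      (∀ y ∈ Metric.ball (0 : 𝔼) 1, |iterPartial (j :: L) (fun y => f y 0) y| ≤ B) →
      |iterPartial (j :: L) (fun y => f y T) 0| ≤ C * (A + B) := by
  obtain ⟨K, hK1, heq⟩ := exists_biharmonic_heat_profile n
  obtain ⟨φ, hφ⟩ := exists_isCutoff n
  obtain ⟨D, hD, hGD⟩ := exists_bound_iterPartial_biLapCommutator K hφ.smooth
    hφ.hasCompactSupport hφ.eq_one L
  set V : ℝ := volume.real (Metric.closedBall (0 : 𝔼) (3 / 4)) with hV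
  have hV0 : 0 ≤ V := measureReal_nonneg
  have hI0 : 0 ≤ ∫ z, ‖K z‖ := integral_nonneg fun z => norm_nonneg _
  refine ⟨4 / 3 * (D * V) + ∫ z, ‖K z‖, by positivity,
    fun A B hA hB T hT hT1 f hf hfA hfB => ?_⟩
  set v : 𝔼 → ℝ → ℝ := fun x t => iterPartial (j :: L) (fun y => f y t) x with hvdef
  have hv : SolvesBiharmonic T v := hf.iterPartial hT (j :: L)
  have hderiv : ∀ τ ∈ Ioo 0 T,
      |∫ y, v y τ * biLapCommutator φ (dilate K (dilationFactor T τ)) y| ≤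
        A * D * V * τ ^ (-(1 / 4) : ℝ) := by
    intro τ hτ
    have hsl := contDiff_slice hf.smooth (Ioo_subset_Icc_self hτ)
    set G := biLapCommutator φ (dilate K (dilationFactor T τ))
    have hG : ContDiff ℝ ∞ G := contDiff_biLapCommutator hφ.smooth (contDiff_dilate (K.smooth ⊤) _)
    have hGs : tsupport G ⊆ Metric.closedBall 0 (3 / 4) :=
      (tsupport_biLapCommutator_subset _ _).trans hφ.tsupport_subset
    have hGc : HasCompactSupport G :=
      (isCompact_closedBall _ _).of_isClosed_subset (isClosed_tsupport _) hGs
    have hparts := integral_mul_iterPartial (contDiff_partialDeriv hsl j) hG hGc L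
    have habs : |∫ y, v y τ * G y| =
        |∫ y, partialDeriv j (fun y => f y τ) y * iterPartial L G y| := by
      rw [hparts, abs_mul, abs_pow, abs_neg, abs_one, one_pow, one_mul]
      rfl
    have hzero : ∀ y ∉ Metric.closedBall (0 : 𝔼) (3 / 4),
        partialDeriv j (fun y => f y τ) y * iterPartial L G y = 0 := by
      intro y hy
      rw [image_eq_zero_of_notMem_tsupport
        (fun h => hy (hGs (tsupport_iterPartial_subset G L h))), mul_zero]
    rw [habs, ← setIntegral_eq_integral_of_forall_compl_eq_zero hzero, ← Real.norm_eq_abs]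
    have hvol : volume (Metric.closedBall (0 : 𝔼) (3 / 4)) < ⊤ :=
      (isCompact_closedBall (0 : 𝔼) (3 / 4)).measure_lt_top
    refine (norm_setIntegral_le_of_norm_le_const (C := A * τ ^ (-(1 / 4) : ℝ) * D)
      hvol fun y hy => ?_).trans_eq ?_
    · rw [norm_mul]
      refine mul_le_mul (hfA τ hτ y (Metric.closedBall_subset_ball (by norm_num) hy))
        (hGD _ (dilationFactor_pos hτ.2) y) (norm_nonneg _) ?_
      exact mul_nonneg hA (Real.rpow_nonneg hτ.1.le _)
    · rw [← hV]; ring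
  have hbound : ∀ τ ∈ Ioo 0 T, |testedSolution K φ T v τ| ≤
      (4 / 3 * (D * V) + ∫ z, ‖K z‖) * (A + B) := by
    intro τ hτ
    have h1 := abs_sub_le_of_abs_deriv_le (F := testedSolution K φ T v) hτ.1.le
      ((continuousOn_testedSolution K.continuous hφ hv).mono fun σ hσ =>
        ⟨hσ.1, hσ.2.trans_lt hτ.2⟩)
      (fun σ hσ => hasDerivAt_testedSolution (K.smooth ⊤) heq hφ hv ⟨hσ.1, hσ.2.trans hτ.2⟩)
      (fun σ hσ => hderiv σ ⟨hσ.1, hσ.2.trans hτ.2⟩)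
    have h2 := abs_testedSolution_zero_le K hφ hT hB (v := v) hfB
    have h3 : τ ^ (3 / 4 : ℝ) ≤ 1 :=
      Real.rpow_le_one hτ.1.le (hτ.2.le.trans hT1) (by norm_num)
    have h4 : 4 / 3 * (A * D * V) * τ ^ (3 / 4 : ℝ) ≤ 4 / 3 * (A * D * V) * 1 := by gcongr
    have h5 : |testedSolution K φ T v τ| ≤
        |testedSolution K φ T v τ - testedSolution K φ T v 0| + |testedSolution K φ T v 0| := by
      have := abs_add_le (testedSolution K φ T v τ - testedSolution K φ T v 0)
        (testedSolution K φ T v 0)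
      rwa [sub_add_cancel] at this
    have h6 : 0 ≤ 4 / 3 * (D * V) * B := by positivity
    have h7 : 0 ≤ (∫ z, ‖K z‖) * A := by positivity
    linarith
  refine le_of_tendsto (tendsto_testedSolution K hK1 hφ hT hv).abs ?_
  filter_upwards [Ioo_mem_nhdsLT hT] with τ hτ
  exact hbound τ hτ

end InteriorEstimate

/-! ### Pointwise bounds at all scales -/

section PointwiseBounds

open Set

variable {n : ℕ}

local notation "𝔼" => EuclideanSpace ℝ (Fin n)

theorem abs_iterPartial_le_gradNorm {f : 𝔼 → ℝ} (hf : ContDiff ℝ ∞ f) (L : List (Fin n)) (x : 𝔼) :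
    |iterPartial L f x| ≤ gradNorm L.length f x := by
  refine Real.le_sqrt_of_sq_le ?_
  have h := iteratedFDeriv_single_eq_iterPartial hf L.get x
  rw [List.ofFn_get] at h
  rw [sq_abs, ← h]
  exact Finset.single_le_sum (f := fun J : Fin L.length → Fin n =>
    (iteratedFDeriv ℝ L.length f x (fun a => EuclideanSpace.single (J a) (1 : ℝ))) ^ 2)
    (fun J _ => sq_nonneg _) (Finset.mem_univ L.get)

theorem gradNorm_le {f : 𝔼 → ℝ} (hf : ContDiff ℝ ∞ f) {i : ℕ} {x : 𝔼} {C : ℝ} (hC : 0 ≤ C)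
    (h : ∀ L : List (Fin n), L.length = i → |iterPartial L f x| ≤ C) :
    gradNorm i f x ≤ n ^ i * C := by
  refine Real.sqrt_le_iff.2 ⟨by positivity, ?_⟩
  calc ∑ J : Fin i → Fin n,
        (iteratedFDeriv ℝ i f x (fun a => EuclideanSpace.single (J a) (1 : ℝ))) ^ 2
      ≤ ∑ _J : Fin i → Fin n, C ^ 2 := by
        refine Finset.sum_le_sum fun J _ => ?_
        rw [iteratedFDeriv_single_eq_iterPartial hf]
        exact sq_le_sq' (abs_le.1 (h _ (by simp))).1 (abs_le.1 (h _ (by simp))).2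
    _ = (n ^ i : ℕ) * C ^ 2 := by simp
    _ ≤ ((n ^ i : ℕ) ^ 2 : ℕ) * C ^ 2 := by
        exact mul_le_mul_of_nonneg_right
          (by exact_mod_cast Nat.le_self_pow two_ne_zero (n ^ i)) (sq_nonneg C)
    _ = (n ^ i * C) ^ 2 := by push_cast; ring

theorem gradNorm_nonneg (i : ℕ) (f : 𝔼 → ℝ) (x : 𝔼) : 0 ≤ gradNorm i f x := Real.sqrt_nonneg _

theorem gradNorm_one_pow_four_le_flowQ {s : ℕ} (hs : 1 ≤ s) (u : 𝔼 → ℝ → ℝ) (x : 𝔼) (t : ℝ) :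
    gradNorm 1 (fun y => u y t) x ^ 4 ≤ flowQ s u x t := by
  set g := gradNorm 1 (fun y => u y t) x
  have hg : 0 ≤ g := gradNorm_nonneg _ _ _
  have hs' : (s : ℝ) ≠ 0 := by positivity
  have h1 : g ^ (s : ℝ) ≤ ∑ i ∈ Finset.Icc 1 s,
      gradNorm i (fun y => u y t) x ^ ((s : ℝ) / (i : ℝ)) := by
    have := Finset.single_le_sum
      (f := fun i : ℕ => gradNorm i (fun y => u y t) x ^ ((s : ℝ) / (i : ℝ)))
      (fun i _ => Real.rpow_nonneg (gradNorm_nonneg _ _ _) _)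
      (Finset.mem_Icc.2 ⟨le_rfl, hs⟩)
    simpa using this
  calc g ^ 4 = (g ^ (s : ℝ)) ^ ((4 : ℝ) / s) := by
        rw [← Real.rpow_mul hg, mul_div_cancel₀ _ hs', ← Real.rpow_natCast]
        norm_num
    _ ≤ flowQ s u x t :=
        Real.rpow_le_rpow (Real.rpow_nonneg hg _) h1 (by positivity)

theorem pow_four_mul_flowQ_le {s : ℕ} (hs : 1 ≤ s) {u : 𝔼 → ℝ → ℝ} {x : 𝔼} {t r D : ℝ}
    (hr : 0 ≤ r) (hD : 1 ≤ D)
    (h : ∀ i ∈ Finset.Icc 1 s, r ^ i * gradNorm i (fun y => u y t) x ≤ D) :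
    r ^ 4 * flowQ s u x t ≤ (s * D ^ s) ^ ((4 : ℝ) / s) := by
  have hs' : (s : ℝ) ≠ 0 := by positivity
  have hr4 : r ^ 4 = (r ^ s) ^ ((4 : ℝ) / s) := by
    rw [← Real.rpow_natCast r s, ← Real.rpow_mul hr, mul_div_cancel₀ _ hs', ← Real.rpow_natCast]
    norm_num
  have hsum0 : 0 ≤ ∑ i ∈ Finset.Icc 1 s,
      gradNorm i (fun y => u y t) x ^ ((s : ℝ) / (i : ℝ)) :=
    Finset.sum_nonneg fun i _ => Real.rpow_nonneg (gradNorm_nonneg _ _ _) _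
  rw [flowQ, hr4, ← Real.mul_rpow (by positivity) hsum0]
  refine Real.rpow_le_rpow (by positivity) ?_ (by positivity)
  rw [Finset.mul_sum]
  calc ∑ i ∈ Finset.Icc 1 s, r ^ s * gradNorm i (fun y => u y t) x ^ ((s : ℝ) / (i : ℝ))
      ≤ ∑ _i ∈ Finset.Icc 1 s, D ^ s := by
        refine Finset.sum_le_sum fun i hi => ?_
        obtain ⟨hi1, -⟩ := Finset.mem_Icc.1 hi
        have hi1' : (1 : ℝ) ≤ i := by exact_mod_cast hi1
        have hri : r ^ s = (r ^ i) ^ ((s : ℝ) / i) := by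
          rw [← Real.rpow_natCast r i, ← Real.rpow_mul hr, mul_div_cancel₀ _ (by positivity),
            Real.rpow_natCast]
        rw [hri, ← Real.mul_rpow (by positivity) (gradNorm_nonneg _ _ _)]
        calc (r ^ i * gradNorm i (fun y => u y t) x) ^ ((s : ℝ) / i)
            ≤ D ^ ((s : ℝ) / i) := Real.rpow_le_rpow
              (mul_nonneg (by positivity) (gradNorm_nonneg _ _ _)) (h i hi) (by positivity)
          _ ≤ D ^ (s : ℝ) := Real.rpow_le_rpow_of_exponent_le hD
              (div_le_self (by positivity) hi1')
          _ = D ^ s := Real.rpow_natCast _ _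
    _ = s * D ^ s := by simp

theorem mul_abs_partialDeriv_le {s : ℕ} (hs : 1 ≤ s) {k₀ : ℝ} (hk₀ : 0 ≤ k₀)
    {u : 𝔼 → ℝ → ℝ} {x : 𝔼} {r τ : ℝ} (hr : 0 < r) (hτ : 0 < τ)
    (hu : ContDiff ℝ ∞ fun y => u y (r ^ 4 * τ)) (h : r ^ 4 * τ * flowQ s u x (r ^ 4 * τ) ≤ k₀)
    (j : Fin n) :
    r * |partialDeriv j (fun y => u y (r ^ 4 * τ)) x| ≤
      k₀ ^ (1 / 4 : ℝ) * τ ^ (-(1 / 4) : ℝ) := by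
  set a := |partialDeriv j (fun y => u y (r ^ 4 * τ)) x|
  have ha : 0 ≤ a := abs_nonneg _
  have h1 : a ^ 4 ≤ flowQ s u x (r ^ 4 * τ) := by
    have h2 : a ≤ gradNorm 1 (fun y => u y (r ^ 4 * τ)) x := abs_iterPartial_le_gradNorm hu [j] x
    exact (pow_le_pow_left₀ ha h2 4).trans (gradNorm_one_pow_four_le_flowQ hs u x _)
  have h2 : (r * a) ^ 4 ≤ k₀ / τ := by
    rw [le_div_iff₀ hτ]
    calc (r * a) ^ 4 * τ = r ^ 4 * τ * a ^ 4 := by ring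
      _ ≤ r ^ 4 * τ * flowQ s u x (r ^ 4 * τ) := by gcongr
      _ ≤ k₀ := h
  calc r * a = ((r * a) ^ 4) ^ (1 / 4 : ℝ) := by
        have := Real.pow_rpow_inv_natCast (x := r * a) (by positivity) (n := 4) (by norm_num)
        rw [one_div]
        exact_mod_cast this.symm
    _ ≤ (k₀ / τ) ^ (1 / 4 : ℝ) := Real.rpow_le_rpow (by positivity) h2 (by norm_num)
    _ = k₀ ^ (1 / 4 : ℝ) * τ ^ (-(1 / 4) : ℝ) := by
        rw [Real.div_rpow hk₀ hτ.le, Real.rpow_neg hτ.le, div_eq_mul_inv]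

/-- The scale-invariant interior estimate for all derivatives of order between `1` and `s`. -/
theorem exists_pow_mul_abs_iterPartial_le (n s : ℕ) (hs : 1 ≤ s) (k₀ k₁ : ℝ) (hk₀ : 0 ≤ k₀) :
    ∃ C : ℝ, 1 ≤ C ∧ ∀ (T : ℝ) (u : EuclideanSpace ℝ (Fin n) → ℝ → ℝ), 0 < T →
      SolvesBiharmonic T u →
      (∀ x, ∀ t ∈ Icc 0 T, t * flowQ s u x t ≤ k₀) →
      (∀ x ∈ Metric.ball 0 1, ∀ L : List (Fin n), L.length ≤ s →
        |iterPartial L (fun y => u y 0) x| ≤ Real.sqrt k₁) →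
      ∀ x ∈ Metric.ball 0 1, ∀ t ∈ Icc 0 T, t ≤ (1 - ‖x‖) ^ 4 →
        ∀ L : List (Fin n), L ≠ [] → L.length ≤ s →
          (1 - ‖x‖) ^ L.length * |iterPartial L (fun y => u y t) x| ≤ C := by
  set A := k₀ ^ (1 / 4 : ℝ)
  set B := Real.sqrt k₁
  have hA : 0 ≤ A := Real.rpow_nonneg hk₀ _
  have hB : 0 ≤ B := Real.sqrt_nonneg _
  obtain ⟨C, hC, hunit⟩ := exists_bound_of_length_le (n := n)
    (P := fun L C => L ≠ [] → ∀ T : ℝ, 0 < T → T ≤ 1 →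
      ∀ f : EuclideanSpace ℝ (Fin n) → ℝ → ℝ, SolvesBiharmonic T f →
      (∀ j, ∀ τ ∈ Ioo 0 T, ∀ y ∈ Metric.ball 0 1,
        |partialDeriv j (fun y => f y τ) y| ≤ A * τ ^ (-(1 / 4) : ℝ)) →
      (∀ y ∈ Metric.ball 0 1, |iterPartial L (fun y => f y 0) y| ≤ B) →
      |iterPartial L (fun y => f y T) 0| ≤ C)
    (fun L a b hab h hL T hT hT1 f hf hfA hfB => (h hL T hT hT1 f hf hfA hfB).trans hab)
    (fun L => by
      cases L with
      | nil => exact ⟨0, le_rfl, fun h => absurd rfl h⟩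
      | cons j L =>
        obtain ⟨C, hC, h⟩ := exists_interior_bound j L
        exact ⟨C * (A + B), by positivity, fun _ T hT hT1 f hf hfA hfB =>
          h A B hA hB T hT hT1 f hf (hfA j) hfB⟩) s
  refine ⟨1 + C + B, by linarith, fun T u hT hu hk hi x hx t ht htr L hL hLs => ?_⟩
  have hx1 : ‖x‖ < 1 := mem_ball_zero_iff.1 hx
  set r := 1 - ‖x‖ with hrdef
  have hr : 0 < r := by linarith
  have hr1 : r ≤ 1 := by linarith [norm_nonneg x]
  have hball : ∀ y ∈ Metric.ball (0 : EuclideanSpace ℝ (Fin n)) 1,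
      x + r • y ∈ Metric.ball (0 : EuclideanSpace ℝ (Fin n)) 1 := by
    intro y hy
    rw [mem_ball_zero_iff] at hy ⊢
    calc ‖x + r • y‖ ≤ ‖x‖ + r * ‖y‖ := by
          refine (norm_add_le _ _).trans_eq ?_
          rw [norm_smul, Real.norm_of_nonneg hr.le]
      _ < ‖x‖ + r * 1 := by gcongr
      _ = 1 := by rw [hrdef]; ring
  have hinit : ∀ y ∈ Metric.ball (0 : EuclideanSpace ℝ (Fin n)) 1,
      r ^ L.length * |iterPartial L (fun y => u y 0) y| ≤ B := by
    intro y hy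
    calc r ^ L.length * |iterPartial L (fun y => u y 0) y| ≤ 1 * B :=
          mul_le_mul (pow_le_one₀ hr.le hr1) (hi y hy L hLs) (abs_nonneg _) zero_le_one
      _ = B := one_mul _
  rcases ht.1.eq_or_lt with h0 | h0
  · rw [← h0]
    linarith [hinit x hx]
  · set T' := t / r ^ 4 with hT'
    have hT'0 : 0 < T' := by positivity
    have hT't : r ^ 4 * T' = t := mul_div_cancel₀ _ (by positivity)
    have hsl : ∀ τ ∈ Icc 0 T', ContDiff ℝ ∞ fun y => u y (r ^ 4 * τ) := fun τ hτ =>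
      contDiff_slice hu.smooth ⟨mul_nonneg (by positivity) hτ.1,
        (mul_le_mul_of_nonneg_left hτ.2 (by positivity)).trans (hT't.le.trans ht.2)⟩
    have hmain := hunit L hLs hL T' hT'0 ((div_le_one (by positivity)).2 htr) _
      (hu.rescale hr (hT't.le.trans ht.2) x) ?_ ?_
    · rw [iterPartial_comp_affine (hsl T' (right_mem_Icc.2 hT'0.le))] at hmain
      simp only [smul_zero, add_zero, hT't, abs_mul, abs_of_pos (pow_pos hr L.length)] at hmain
      linarith
    · intro j τ hτ y hy
      have hsl' := hsl τ (Ioo_subset_Icc_self hτ)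
      rw [partialDeriv_comp_affine _ hsl', abs_mul, abs_of_pos hr]
      refine mul_abs_partialDeriv_le hs hk₀ hr hτ.1 hsl' (hk _ _ ?_) j
      exact ⟨mul_nonneg (by positivity) hτ.1.le,
        (mul_le_mul_of_nonneg_left hτ.2.le (by positivity)).trans (hT't.le.trans ht.2)⟩
    · intro y hy
      rw [iterPartial_comp_affine (hsl 0 (left_mem_Icc.2 hT'0.le)), abs_mul,
        abs_of_pos (pow_pos hr L.length), mul_zero]
      exact hinit _ (hball y hy)

end PointwiseBounds

theorem corollary2p3 (n s : ℕ) (hs : 4 ≤ s) (k₀ k₁ : ℝ) (hk₀ : 0 ≤ k₀) (hk₁ : 0 ≤ k₁) :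
    ∃ N : ℝ, 0 < N ∧
      ∀ (T : ℝ) (u : EuclideanSpace ℝ (Fin n) → ℝ → ℝ), 0 < T →
        IsSmoothBiharmonicFlow T u →
        (∀ x : EuclideanSpace ℝ (Fin n), ∀ t ∈ Set.Icc 0 T, t * flowQ s u x t ≤ k₀) →
        (∀ x ∈ Metric.ball (0 : EuclideanSpace ℝ (Fin n)) 1,
          ∑ i ∈ Finset.range (2 * n + s + 2), gradNorm i (fun y => u y 0) x ^ 2 ≤ k₁) →
        ∀ x ∈ Metric.closedBall (0 : EuclideanSpace ℝ (Fin n)) 1, ∀ t ∈ Set.Icc 0 T,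
          N * t ≤ (1 - ‖x‖) ^ 4 → t ≤ 1 / N →
            (1 - ‖x‖) ^ 4 * flowQ s u x t ≤ N ∧ |u x t| ≤ Real.sqrt k₁ + 1 := by
  obtain ⟨C, hC, hest⟩ := exists_pow_mul_abs_iterPartial_le n s (by omega) k₀ k₁ hk₀
  set D : ℝ := (n + 1) ^ s * C
  have hn1 : (1 : ℝ) ≤ n + 1 := by linarith [(Nat.cast_nonneg n : (0 : ℝ) ≤ n)]
  have hD : 1 ≤ D := one_le_mul_of_one_le_of_one_le (one_le_pow₀ hn1) hC
  set N₁ : ℝ := (s * D ^ s) ^ ((4 : ℝ) / s)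
  have hN₁ : 0 ≤ N₁ := by positivity
  have hC0 : 0 ≤ C := by linarith
  have hnC : 0 ≤ n * (n * C) := by positivity
  refine ⟨1 + n * (n * C) + N₁, by linarith, fun T u hT hflow hk hi x hx t ht hNt _ => ?_⟩
  set N := 1 + n * (n * C) + N₁
  have hN : 1 ≤ N := by linarith
  have hsol := hflow.solvesBiharmonic
  have hsl : ∀ τ ∈ Set.Icc 0 T, ContDiff ℝ ∞ fun y => u y τ := fun τ hτ =>
    contDiff_slice hflow.smooth hτ
  have h0 : (0 : ℝ) ∈ Set.Icc 0 T := Set.left_mem_Icc.2 hT.le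
  have hinit : ∀ x ∈ Metric.ball (0 : EuclideanSpace ℝ (Fin n)) 1, ∀ L : List (Fin n),
      L.length ≤ s → |iterPartial L (fun y => u y 0) x| ≤ Real.sqrt k₁ := by
    intro y hy L hL
    refine (abs_iterPartial_le_gradNorm (hsl 0 h0) L y).trans (Real.le_sqrt_of_sq_le ?_)
    exact (Finset.single_le_sum (f := fun i => gradNorm i (fun y => u y 0) y ^ 2)
      (fun i _ => sq_nonneg _) (Finset.mem_range.2 (by omega))).trans (hi y hy)
  have hx1 : ‖x‖ ≤ 1 := mem_closedBall_zero_iff.1 hx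
  rcases hx1.eq_or_lt with hx1 | hx1
  · -- on the boundary sphere only time zero is admissible
    have ht0 : t = 0 := by
      rw [hx1] at hNt
      norm_num at hNt
      have := ht.1
      nlinarith
    refine ⟨by rw [hx1]; norm_num; linarith, ?_⟩
    have hcl : x ∈ closure (Metric.ball (0 : EuclideanSpace ℝ (Fin n)) 1) := by
      rwa [closure_ball _ one_ne_zero]
    have hclosed : IsClosed {y : EuclideanSpace ℝ (Fin n) | |u y 0| ≤ Real.sqrt k₁} :=
      isClosed_le (hsl 0 h0).continuous.abs continuous_const
    have hmem := closure_minimal (fun y hy => hinit y hy [] (Nat.zero_le _)) hclosed hcl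
    rw [ht0]
    have : |u x 0| ≤ Real.sqrt k₁ := hmem
    linarith
  · have hxb : x ∈ Metric.ball (0 : EuclideanSpace ℝ (Fin n)) 1 := mem_ball_zero_iff.2 hx1
    set r := 1 - ‖x‖
    have hr : 0 < r := by simp only [r]; linarith
    have htr : ∀ τ ∈ Set.Icc 0 t, τ ≤ r ^ 4 := fun τ hτ =>
      le_trans (by nlinarith [hτ.1, hτ.2]) hNt
    have htT : ∀ τ ∈ Set.Icc 0 t, τ ∈ Set.Icc 0 T := fun τ hτ => ⟨hτ.1, hτ.2.trans ht.2⟩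
    have hder : ∀ τ ∈ Set.Icc 0 t, ∀ L : List (Fin n), L ≠ [] → L.length ≤ s →
        r ^ L.length * |iterPartial L (fun y => u y τ) x| ≤ C := fun τ hτ =>
      hest T u hT hsol hk hinit x hxb τ (htT τ hτ) (htr τ hτ)
    have htt : t ∈ Set.Icc 0 t := Set.right_mem_Icc.2 ht.1
    constructor
    · refine (pow_four_mul_flowQ_le (by omega) hr.le hD fun i hi => ?_).trans
        (show N₁ ≤ N by linarith)
      obtain ⟨hi1, his⟩ := Finset.mem_Icc.1 hi
      have hg := gradNorm_le (hsl t ht) (i := i) (x := x) (C := C / r ^ i) (by positivity)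
        fun L hL => by
          rw [le_div_iff₀ (by positivity), mul_comm, ← hL]
          refine hder t htt L ?_ (by omega)
          rintro rfl
          simp at hL
          omega
      calc r ^ i * gradNorm i (fun y => u y t) x ≤ r ^ i * (n ^ i * (C / r ^ i)) := by gcongr
        _ = n ^ i * C := by field_simp
        _ ≤ (n + 1) ^ s * C := by
            gcongr
            calc (n : ℝ) ^ i ≤ (n + 1) ^ i := by gcongr; linarith
              _ ≤ (n + 1) ^ s := pow_le_pow_right₀ hn1 his
    · -- the time derivative is `-Δ² u`, which is controlled because `4 ≤ s`
      have hbound : ∀ τ ∈ Set.Icc 0 t,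
          ‖-biLaplacian (fun y => u y τ) x‖ ≤ n * (n * C) / r ^ 4 := by
        intro τ hτ
        rw [norm_neg, biLaplacian_eq_sumBiLap (hsl τ (htT τ hτ)), Real.norm_eq_abs,
          le_div_iff₀ (by positivity)]
        calc |sumBiLap (fun y => u y τ) x| * r ^ 4
            ≤ (∑ i : Fin n, ∑ j : Fin n, |iterPartial [j, j, i, i] (fun y => u y τ) x|) *
                r ^ 4 := by
              gcongr
              exact (Finset.abs_sum_le_sum_abs _ _).trans
                (Finset.sum_le_sum fun i _ => Finset.abs_sum_le_sum_abs _ _)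
          _ = ∑ i : Fin n, ∑ j : Fin n,
                r ^ 4 * |iterPartial [j, j, i, i] (fun y => u y τ) x| := by
              rw [mul_comm]
              simp only [Finset.mul_sum]
          _ ≤ ∑ _i : Fin n, ∑ _j : Fin n, C :=
              Finset.sum_le_sum fun i _ => Finset.sum_le_sum fun j _ =>
                hder τ hτ [j, j, i, i] (by simp) (by simpa using hs)
          _ = n * (n * C) := by simp
      have hmv := (convex_Icc (0 : ℝ) t).norm_image_sub_le_of_norm_hasDerivWithin_le
        (fun τ hτ => (hflow.equation x τ (htT τ hτ)).mono fun σ hσ => htT σ hσ)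
        hbound (Set.left_mem_Icc.2 ht.1) htt
      have h1 : n * (n * C) / r ^ 4 * ‖t - 0‖ ≤ 1 := by
        rw [sub_zero, Real.norm_of_nonneg ht.1, div_mul_eq_mul_div, div_le_one (by positivity)]
        refine le_trans ?_ hNt
        exact mul_le_mul_of_nonneg_right (by linarith) ht.1
      have h2 : |u x 0| ≤ Real.sqrt k₁ := hinit x hxb [] (Nat.zero_le _)
      have h3 : |u x t - u x 0| ≤ 1 := hmv.trans h1
      have h4 := abs_add_le (u x t - u x 0) (u x 0)
      rw [sub_add_cancel] at h4
      linarith
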